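/- Consider the linear system $x_{k+1}=Ax_k+\omega_k$, $y_k=Cx_k+\nu_k$, $k=0,1,2,\dots$, with $x_k\in\mathbb{R}^n$, $y_k\in\mathbb{R}^m$, $q=\mathrm{rank}(C)$. Here $x_0\sim\mathcal N(\bar x_0,P_0)$, the process noise $\omega_k\sim\mathcal N(0,Q)$ and the measurement noise $\nu_k\sim\mathcal N(0,R)$ are white (independent in time), $x_0$, $(\omega_k)_k$ and $(\nu_k)_k$ are independent, and $P_0,Q,R$ are positive definite. Local estimates. Put $\hat x^L_{k|k-1}=\mathbb E[x_k\mid y_0,\dots,y_{k-1}]$, $\hat x^L_k=\mathbb E[x_k\mid y_0,\dots,y_k]$, with error covariance matrices $P^L_{k|k-1}=\mathbb E[(x_k-\hat x^L_{k|k-1})(x_k-\hat x^L_{k|k-1})']$ and $P^L_k=\mathbb E[(x_k-\hat x^L_k)(x_k-\hat x^L_k)']$, and let $z_k=\hat x^L_k-\hat x^L_{k|k-1}$. Let $U_k$ be any orthogonal matrix diagonalizing $P^L_{k|k-1}-P^L_k$ with the positive eigenvalues placed first, $U_k'(P^L_{k|k-1}-P^L_k)U_k=\mathrm{diag}(\Lambda_k,0)$,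 where $\Lambda_k$ is the $q\times q$ diagonal matrix of the positive eigenvalues. The normalized innovation is $\epsilon_k=[\Lambda_k^{-1/2},0]\,U_k'z_k\in\mathbb R^q$. Communication scheme. Set $\gamma_0=1$. For $k\ge1$ let $t_k=\max\{t<k:\gamma_t=1\}$, $\tau_k=k-t_k$, let the real threshold $\delta_k$ be prespecified or, more generally, be any function of $\gamma_0,\dots,\gamma_{k-1}$, and let $\gamma_k=1$ (the sensor transmits $\hat x^L_k$) if $\sum_{i=t_k+1}^k\|\epsilon_i\|^2>\delta_k$ and $\gamma_k=0$ (no transmission) otherwise. The remote center knows $\mathcal I_0^k=\{\gamma_j,\ \gamma_j\hat x^L_j:0\le j\le k\}$; its estimate and MSE matrix are $\hat x_k=\mathbb E[x_k\mid\mathcal I_0^k]$ and $P_k=\mathbb E[(x_k-\hat x_k)(x_k-\hat x_k)'\mid\mathcal I_0^k]$. Theorem. For every $k$, almost surely, if $\gamma_k=0$ then, with $\tau=\tau_k$, $$\mathrm{tr}(P_k)\le \mathrm{tr}(P^L_k)+\tau\,q\,\beta(\tau,\delta_k)\,\lambda_{\max}(A^P_k),\qquad \beta(\tau,\delta)=\frac{\Pr(\chi^2_{\tau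 q+2}\le\delta)}{\Pr(\chi^2_{\tau q}\le\delta)},$$ where $A^P_k$ is the block-diagonal matrix with diagonal blocks $A^i(P^L_{k-i|k-i-1}-P^L_{k-i})(A^i)'$, $i=0,\dots,\tau-1$, and $\lambda_{\max}$ is the maximum eigenvalue. -/

import Mathlib

open MeasureTheory ProbabilityTheory
open scoped Matrix

noncomputable section

/-- The law `χ²_d`: the law of `‖Z‖²` for a standard Gaussian vector `Z` in `ℝ^d`. -/
def chiSq (d : ℕ) : Measure ℝ :=
  (stdGaussian (EuclideanSpace ℝ (Fin d))).map (fun z => ‖z‖ ^ 2)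

/-- `β(τ, δ) = Pr(χ²_{τ q + 2} ≤ δ) / Pr(χ²_{τ q} ≤ δ)`. -/
def chiSqRatio (q τ : ℕ) (δ : ℝ) : ℝ :=
  (chiSq (τ * q + 2)).real (Set.Iic δ) / (chiSq (τ * q)).real (Set.Iic δ)

/-- Maximum eigenvalue of a real symmetric matrix. -/
def lambdaMax {ι : Type*} [Fintype ι] [DecidableEq ι] (M : Matrix ι ι ℝ) : ℝ :=
  sSup (spectrum ℝ M)

/-- `Uᵀ M U = diag(D)` with `U` orthogonal and with the positive eigenvalues placed first. -/
structure IsOrderedEigendecomposition {n : ℕ} (M U : Matrix (Fin n) (Fin n) ℝ)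
    (D : Fin n → ℝ) : Prop where
  orthogonal : U ∈ Matrix.orthogonalGroup (Fin n) ℝ
  diagonal : Uᵀ * M * U = Matrix.diagonal D
  positive_first : ∀ i j, i ≤ j → 0 < D j → 0 < D i

/-- The `q × n` matrix `[Λ^{-1/2}, 0] Uᵀ`, where `Λ = diag(D_1, …, D_q)`. -/
def normalizer {n : ℕ} (q : ℕ) (U : Matrix (Fin n) (Fin n) ℝ) (D : Fin n → ℝ) :
    Matrix (Fin q) (Fin n) ℝ :=
  (Matrix.of fun (i : Fin q) (j : Fin n) => if (i : ℕ) = j then (√(D j))⁻¹ else 0) * Uᵀ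

/-- The largest index `t < k` at which the decision history `h` shows a transmission. -/
def lastTransmission {k : ℕ} (h : Fin k → Bool) : ℕ :=
  (Finset.univ.filter fun j => h j = true).sup fun j => (j : ℕ)

/-- The event-triggered decisions, `true` meaning transmission, for a sequence `e` of squared norms
of normalized innovations. The rule `thr k` yields the threshold `δ_k` from the decisions before
time `k` (a constant rule is a prespecified threshold). Time `0` counts as a transmission, and for
`k ≥ 1` there is a transmission iff `∑_{t < i ≤ k} e_i > δ_k`, with `t` the last transmission
before `k`. -/
def decision (thr : (k : ℕ) → (Fin k → Bool) → ℝ) (e : ℕ → ℝ) : ℕ → Bool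
  | 0 => true
  | k + 1 =>
    let h : Fin (k + 1) → Bool := fun j => decision thr e j
    decide (thr (k + 1) h < ∑ i ∈ Finset.Ioc (lastTransmission h) (k + 1), e i)
termination_by k => k
decreasing_by exact j.isLt

/-- Data of a stochastic linear system: system matrix, output matrix, noise covariances, mean and
covariance of the initial state, and the random initial state, process noise, measurement noise. -/
structure LinearSystem (Ω : Type*) (n m : ℕ) where
  A : Matrix (Fin n) (Fin n) ℝ
  C : Matrix (Fin m) (Fin n) ℝ
  Q : Matrix (Fin n) (Fin n) ℝ
  R : Matrix (Fin m) (Fin m) ℝ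
  P₀ : Matrix (Fin n) (Fin n) ℝ
  mean₀ : EuclideanSpace ℝ (Fin n)
  x₀ : Ω → EuclideanSpace ℝ (Fin n)
  w : ℕ → Ω → EuclideanSpace ℝ (Fin n)
  v : ℕ → Ω → EuclideanSpace ℝ (Fin m)

namespace LinearSystem

/-- The noises are Gaussian white with covariances `Q` and `R`, the initial state is Gaussian, and
the initial state, the process noise sequence and the measurement noise sequence are (mutually)
independent. Covariance matrices of Gaussian vectors are positive definite. -/
structure IsGaussian {Ω : Type*} [MeasurableSpace Ω] {n m : ℕ} (S : LinearSystem Ω n m)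
    (μ : Measure Ω) : Prop where
  posDef_Q : S.Q.PosDef
  posDef_R : S.R.PosDef
  posDef_P₀ : S.P₀.PosDef
  measurable_x₀ : Measurable S.x₀
  measurable_w : ∀ k, Measurable (S.w k)
  measurable_v : ∀ k, Measurable (S.v k)
  law_x₀ : HasLaw S.x₀ (multivariateGaussian S.mean₀ S.P₀) μ
  law_w : ∀ k, HasLaw (S.w k) (multivariateGaussian 0 S.Q) μ
  law_v : ∀ k, HasLaw (S.v k) (multivariateGaussian 0 S.R) μ
  white_w : iIndepFun S.w μ
  white_v : iIndepFun S.v μ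
  indep_w_v : IndepFun (fun ω k => S.w k ω) (fun ω k => S.v k ω) μ
  indep_x₀ : IndepFun S.x₀ (fun ω => (fun k => S.w k ω, fun k => S.v k ω)) μ

variable {Ω : Type*} {n m : ℕ} (S : LinearSystem Ω n m)

/-- The state, `x_{k+1} = A x_k + w_k`. -/
def x : ℕ → Ω → EuclideanSpace ℝ (Fin n)
  | 0, ω => S.x₀ ω
  | k + 1, ω => Matrix.toLpLin 2 2 S.A (x k ω) + S.w k ω

/-- The measurement, `y_k = C x_k + v_k`. -/
def y (k : ℕ) (ω : Ω) : EuclideanSpace ℝ (Fin m) :=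
  Matrix.toLpLin 2 2 S.C (S.x k ω) + S.v k ω

/-- The σ-algebra generated by `y_0, …, y_{k-1}`. -/
@[reducible] def obs (k : ℕ) : MeasurableSpace Ω :=
  ⨆ j : Fin k, MeasurableSpace.comap (S.y j) inferInstance

variable [MeasurableSpace Ω] (μ : Measure Ω)

/-- The one-step local prediction `E[x_k | y_0, …, y_{k-1}]`. -/
def xPred (k : ℕ) : Ω → EuclideanSpace ℝ (Fin n) := μ[S.x k | S.obs k]

/-- The local estimate `E[x_k | y_0, …, y_k]`. -/
def xLoc (k : ℕ) : Ω → EuclideanSpace ℝ (Fin n) := μ[S.x k | S.obs (k + 1)]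

/-- The local prediction error covariance `P^L_{k|k-1}`. -/
def PPred (k : ℕ) : Matrix (Fin n) (Fin n) ℝ :=
  Matrix.of fun i j =>
    ∫ ω, (S.x k ω - S.xPred μ k ω) i * (S.x k ω - S.xPred μ k ω) j ∂μ

/-- The local estimation error covariance `P^L_k`. -/
def PLoc (k : ℕ) : Matrix (Fin n) (Fin n) ℝ :=
  Matrix.of fun i j =>
    ∫ ω, (S.x k ω - S.xLoc μ k ω) i * (S.x k ω - S.xLoc μ k ω) j ∂μ

/-- The estimate innovation `z_k`. -/
def z (k : ℕ) (ω : Ω) : EuclideanSpace ℝ (Fin n) := S.xLoc μ k ω - S.xPred μ k ω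

/-- The block-diagonal matrix with the `τ` diagonal blocks
`A^i (P^L_{k-i|k-i-1} - P^L_{k-i}) (A^i)ᵀ`, `0 ≤ i ≤ τ - 1`. -/
def AP (k τ : ℕ) : Matrix (Fin n × Fin τ) (Fin n × Fin τ) ℝ :=
  Matrix.blockDiagonal fun i : Fin τ =>
    S.A ^ (i : ℕ) * (S.PPred μ (k - i) - S.PLoc μ (k - i)) * (S.A ^ (i : ℕ))ᵀ

/-- The rank `q` of the output matrix. -/
def q : ℕ := S.C.rank

/-! The communication scheme. The eigendecompositions `(U_k, D_k)` of `P^L_{k|k-1} - P^L_k` and the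
threshold rules `thr` are parameters. -/

variable (U : ℕ → Matrix (Fin n) (Fin n) ℝ) (D : ℕ → Fin n → ℝ)
  (thr : (k : ℕ) → (Fin k → Bool) → ℝ)

/-- The normalized innovation `ε_k = F_k z_k` in `ℝ^q`, with `F_k = [Λ_k^{-1/2}, 0] U_kᵀ`. -/
def innov (k : ℕ) (ω : Ω) : EuclideanSpace ℝ (Fin S.q) :=
  Matrix.toLpLin 2 2 (normalizer S.q (U k) (D k)) (S.z μ k ω)

/-- The decision `γ_k`; `true` is `γ_k = 1`, `false` is `γ_k = 0`. -/
def gam (k : ℕ) (ω : Ω) : Bool :=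
  decision thr (fun i => ‖S.innov μ U D i ω‖ ^ 2) k

/-- The threshold `δ_k`. -/
def delta (k : ℕ) (ω : Ω) : ℝ := thr k fun j => S.gam μ U D thr j ω

/-- The time `τ_k = k - t_k` elapsed since the latest transmission before time `k`. -/
def tau (k : ℕ) (ω : Ω) : ℕ :=
  k - lastTransmission fun j : Fin k => S.gam μ U D thr j ω

/-- The σ-algebra generated by the information `γ_j`, `γ_j x̂^L_j`, `0 ≤ j ≤ k`, available at the
remote center. -/
@[reducible] def info (k : ℕ) : MeasurableSpace Ω :=
  ⨆ j : Fin (k + 1),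
    MeasurableSpace.comap (S.gam μ U D thr j) inferInstance ⊔
    MeasurableSpace.comap
      (fun ω => if S.gam μ U D thr j ω = true then S.xLoc μ j ω else 0) inferInstance

/-- The remote MMSE estimate `x̂_k`. -/
def xRem (k : ℕ) : Ω → EuclideanSpace ℝ (Fin n) := μ[S.x k | S.info μ U D thr k]

/-- The remote MSE matrix `P_k`, a conditional expectation given the information up to `k`. -/
def PRem (k : ℕ) (ω : Ω) : Matrix (Fin n) (Fin n) ℝ :=
  Matrix.of fun i j =>
    (μ[fun ω' => (S.x k ω' - S.xRem μ U D thr k ω') i * (S.x k ω' - S.xRem μ U D thr k ω') j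
      | S.info μ U D thr k]) ω

end LinearSystem

end

/-! Fix one of the finitely many decision histories up to time `k`, with last transmission at `t`
and silence until `k = t + τ`; along it `τ` and all thresholds are constants. The remote center can
form the prediction `A ^ τ x̂ᴸ_t`, and a conditional mean minimizes the conditional mean squared
error (`trace_PRem_le`), so it is enough to bound the error of this prediction. That error is `(x_k
- x̂ᴸ_k) + W`, where `W = ∑ A ^ i z_{k-i}` over `i < τ` (`xLoc_add`). The local error is centered
and independent of `y_0, …, y_k`: the cross term vanishes, and the first square contributes
`tr(Pᴸ_k)`.

The Kalman recursion shows that the stack `X` of the `τ` normalized innovations after `t` is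
standard Gaussian in `ℝ^{τq}` and independent of `y_0, …, y_t` (`hasLaw_innovStack`,
`indep_innovStack`), and that `W` is a linear function of `X`. On the fixed history, an event known
to the center is an event of `y_0, …, y_t` intersected with `X ∈ G`, where `G` bounds the partial
sums of the squared block norms by the thresholds (`exists_obs_inter_histSet_eq`,
`histSet_eq_inter`). What remains is a Gaussian estimate of `‖W‖²` on `G`.

Only block norms enter `G`, and decreasing them stays in `G`. Hence `G` is invariant under sign
changes of single blocks, which kills the cross terms between blocks and gives `E[‖W‖²; G] ≤ λ_max
E[‖X‖²; G]` (`setIntegral_norm_sq_sum_blocks_le`). Moreover `G` is star-shaped and, by its last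
constraint, lies in the ball `‖x‖² ≤ δ_k`. Given the direction of `X`, passing from the ball to `G`
only cuts off large radii, so the conditional mean of `‖X‖²` on `G` is at most that on the ball
(`setIntegral_norm_sq_stdGaussian_starShaped_le`). On the ball it equals `τ q β`, because
multiplying the radial density in dimension `d` by `r²` produces the one in dimension `d + 2`, up to
the factor `d` (`setIntegral_norm_sq_stdGaussian_ball`). -/

set_option linter.unusedSectionVars false

noncomputable section

/-! ### Standard Gaussian measure: density, polar coordinates, star-shaped events -/

section StdGaussian

variable {E : Type*} [NormedAddCommGroup E] [InnerProductSpace ℝ E] [FiniteDimensional ℝ E]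
  [MeasurableSpace E] [BorelSpace E]

/-- The density of the standard Gaussian measure. -/
theorem stdGaussian_eq_withDensity :
    stdGaussian E = (volume : Measure E).withDensity fun x => ENNReal.ofReal
      ((2 * Real.pi) ^ (-(Module.finrank ℝ E / 2 : ℝ)) * Real.exp (-(1 / 2) * ‖x‖ ^ 2)) := by
  have hpi : (0 : ℝ) < 2 * Real.pi := by positivity
  set c : ℝ := (2 * Real.pi) ^ (-(Module.finrank ℝ E / 2 : ℝ)) with hc
  have hcpos : 0 < c := Real.rpow_pos_of_pos hpi _
  have hint : ∫ v : E, Real.exp (-(1 / 2) * ‖v‖ ^ 2) = c⁻¹ := by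
    rw [GaussianFourier.integral_rexp_neg_mul_sq_norm (by norm_num : (0 : ℝ) < 1 / 2), hc,
      ← Real.rpow_neg hpi.le, neg_neg]
    congr 1
    ring
  have hI : Integrable (fun v : E => c * Real.exp (-(1 / 2) * ‖v‖ ^ 2)) := by
    refine Integrable.const_mul ?_ c
    -- If the integral diverged, its default value 0 would contradict the value `c⁻¹ > 0`.
    by_contra h
    rw [integral_undef h] at hint
    exact (inv_pos.2 hcpos).ne hint
  have : IsFiniteMeasure ((volume : Measure E).withDensity fun x => ENNReal.ofReal
      (c * Real.exp (-(1 / 2) * ‖x‖ ^ 2))) := isFiniteMeasure_withDensity_ofReal hI.2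
  refine Measure.ext_of_charFun (funext fun t => ?_)
  rw [charFun_stdGaussian, charFun_apply,
    integral_withDensity_eq_integral_toReal_smul (by fun_prop) (by simp)]
  have h1 : ∀ x : E, (ENNReal.ofReal (c * Real.exp (-(1 / 2) * ‖x‖ ^ 2))).toReal •
      Complex.exp ((inner ℝ x t : ℝ) * Complex.I) =
      (c : ℂ) * Complex.exp (-(1 / 2 : ℂ) * ‖x‖ ^ 2 + Complex.I * (inner ℝ t x : ℝ)) := by
    intro x
    rw [ENNReal.toReal_ofReal (by positivity), Complex.real_smul, Complex.exp_add,
      real_inner_comm]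
    push_cast
    rw [mul_comm Complex.I]
    ring
  simp_rw [h1]
  rw [integral_const_mul, GaussianFourier.integral_cexp_neg_mul_sq_norm_add (by norm_num)]
  have h2 : (c : ℂ) * (Real.pi / (1 / 2 : ℂ)) ^ (Module.finrank ℝ E / 2 : ℂ) = 1 := by
    have : (Real.pi / (1 / 2 : ℂ)) ^ (Module.finrank ℝ E / 2 : ℂ) =
        (((2 * Real.pi) ^ (Module.finrank ℝ E / 2 : ℝ) : ℝ) : ℂ) := by
      rw [Complex.ofReal_cpow hpi.le]
      push_cast
      congr 1
      ring
    rw [this, hc, ← Complex.ofReal_mul, ← Real.rpow_add hpi]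
    simp
  rw [← mul_assoc, h2, one_mul, Complex.I_sq]
  congr 1
  ring

theorem integral_stdGaussian_eq (f : E → ℝ) :
    ∫ x, f x ∂(stdGaussian E) = (2 * Real.pi) ^ (-(Module.finrank ℝ E / 2 : ℝ)) *
      ∫ x, Real.exp (-(1 / 2) * ‖x‖ ^ 2) * f x := by
  rw [stdGaussian_eq_withDensity,
    integral_withDensity_eq_integral_toReal_smul (by fun_prop) (by simp), ← integral_const_mul]
  refine integral_congr_ae (.of_forall fun x => ?_)
  simp only [smul_eq_mul]
  rw [ENNReal.toReal_ofReal (by positivity)]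
  ring

/-- Polar coordinates for the product of a radial function and a function of the direction. -/
theorem integral_radial_mul_homogeneous (f : ℝ → ℝ) (h : E → ℝ)
    (hh : ∀ r : ℝ, 0 < r → ∀ x, h (r • x) = h x) [Nontrivial E] :
    ∫ x : E, f ‖x‖ * h x = (∫ r : Set.Ioi (0 : ℝ), f r
      ∂Measure.volumeIoiPow (Module.finrank ℝ E - 1)) *
        ∫ x : Metric.sphere (0 : E) 1, h x ∂(volume : Measure E).toSphere := by
  calc ∫ x : E, f ‖x‖ * h x
      = ∫ x : ({(0)}ᶜ : Set E), f ‖x.1‖ * h x.1 ∂((volume : Measure E).comap (↑)) := by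
        rw [integral_subtype_comap (measurableSet_singleton _).compl fun x => f ‖x‖ * h x,
          restrict_compl_singleton]
    _ = ∫ x, h x.1 * f x.2 ∂(volume : Measure E).toSphere.prod
          (.volumeIoiPow (Module.finrank ℝ E - 1)) := by
        rw [← (volume : Measure E).measurePreserving_homeomorphUnitSphereProd.integral_comp
          (Homeomorph.measurableEmbedding _)]
        refine integral_congr_ae (.of_forall fun x => ?_)
        have h0 : 0 < ‖x.1‖ := norm_pos_iff.2 x.2
        simp only [homeomorphUnitSphereProd_apply_fst_coe, homeomorphUnitSphereProd_apply_snd_coe]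
        rw [hh _ (inv_pos.2 h0), mul_comm]
    _ = _ := by
        rw [integral_prod_mul (fun x : Metric.sphere (0 : E) 1 => h x)
          (fun r : Set.Ioi (0 : ℝ) => f r), mul_comm]

/-- Radius and direction are independent under a Gaussian: polar coordinates factor the integral,
and the hypothesis `hf` kills the radial factor because the sphere has nonzero mass. -/
theorem integral_stdGaussian_radial_mul_homogeneous_eq_zero (f : ℝ → ℝ) (h : E → ℝ)
    (hh : ∀ r : ℝ, 0 < r → ∀ x, h (r • x) = h x) [Nontrivial E]
    (hf : ∫ x, f ‖x‖ ∂(stdGaussian E) = 0) :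
    ∫ x, f ‖x‖ * h x ∂(stdGaussian E) = 0 := by
  have hpi : (0 : ℝ) < 2 * Real.pi := by positivity
  have hc : (2 * Real.pi) ^ (-(Module.finrank ℝ E / 2 : ℝ)) ≠ 0 :=
    (Real.rpow_pos_of_pos hpi _).ne'
  rw [integral_stdGaussian_eq] at hf ⊢
  have hf' := (mul_eq_zero.1 hf).resolve_left hc
  have h1 := integral_radial_mul_homogeneous (E := E)
    (fun r => Real.exp (-(1 / 2) * r ^ 2) * f r) (fun _ => 1) (fun _ _ _ => rfl)
  have h2 := integral_radial_mul_homogeneous (E := E)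
    (fun r => Real.exp (-(1 / 2) * r ^ 2) * f r) h hh
  simp only [mul_one] at h1
  rw [hf'] at h1
  have h3 : ∫ _ : Metric.sphere (0 : E) 1, (1 : ℝ) ∂(volume : Measure E).toSphere ≠ 0 := by
    rw [integral_const, smul_eq_mul, mul_one]
    intro h0
    rw [measureReal_eq_zero_iff, Measure.measure_univ_eq_zero] at h0
    exact Measure.toSphere_ne_zero _ h0
  have h4 := (mul_eq_zero.1 h1.symm).resolve_right h3
  simp_rw [← mul_assoc]
  rw [h2, h4]
  simp

theorem integrable_norm_sq_stdGaussian :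
    Integrable (fun x : E => ‖x‖ ^ 2) (stdGaussian E) :=
  (IsGaussian.memLp_two_id (μ := stdGaussian E)).integrable_norm_pow (by norm_num)

theorem integral_norm_sq_stdGaussian :
    ∫ x, ‖x‖ ^ 2 ∂(stdGaussian E) = Module.finrank ℝ E := by
  let b := stdOrthonormalBasis ℝ E
  have h1 : ∀ x : E, ‖x‖ ^ 2 = ∑ i, (innerSL ℝ (b i) x) ^ 2 := fun x => by
    simp [← b.sum_sq_inner_right x]
  have h2 : ∀ i, MemLp (innerSL ℝ (b i)) 2 (stdGaussian E) := fun i =>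
    (innerSL ℝ (b i)).comp_memLp' IsGaussian.memLp_two_id
  have h3 : ∀ i, ∫ x, (innerSL ℝ (b i) x) ^ 2 ∂(stdGaussian E) = 1 := by
    intro i
    have := variance_dual_stdGaussian (innerSL ℝ (b i))
    rw [variance_of_integral_eq_zero (by fun_prop) (integral_strongDual_stdGaussian _)] at this
    rw [this]
    simp
  simp_rw [h1]
  rw [integral_finsetSum _ fun i _ => (h2 i).integrable_sq, Finset.sum_congr rfl fun i _ => h3 i]
  simp

/-- For a star-shaped event inside a centered ball, the conditional mean of `‖x‖²` is at most the
conditional mean on the ball. -/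
theorem setIntegral_norm_sq_stdGaussian_starShaped_le [Nontrivial E] {G : Set E}
    (hG : MeasurableSet G) (hstar : ∀ x ∈ G, ∀ r : ℝ, 0 ≤ r → r ≤ 1 → r • x ∈ G) {δ : ℝ}
    (hδ : ∀ x ∈ G, ‖x‖ ^ 2 ≤ δ) :
    (∫ x in G, ‖x‖ ^ 2 ∂(stdGaussian E)) * (stdGaussian E).real {x | ‖x‖ ^ 2 ≤ δ} ≤
      (∫ x in {x | ‖x‖ ^ 2 ≤ δ}, ‖x‖ ^ 2 ∂(stdGaussian E)) * (stdGaussian E).real G := by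
  set γ := stdGaussian E
  set B : Set E := {x | ‖x‖ ^ 2 ≤ δ} with hB
  have hBm : MeasurableSet B := measurableSet_le (by fun_prop) (by fun_prop)
  have hGB : G ⊆ B := hδ
  have hI : Integrable (fun x : E => ‖x‖ ^ 2) γ := integrable_norm_sq_stdGaussian
  rcases eq_or_ne (γ.real B) 0 with h0 | h0
  · have : γ.real G = 0 := le_antisymm (h0 ▸ measureReal_mono hGB) measureReal_nonneg
    rw [h0, this]
    simp
  have hBpos : 0 < γ.real B := lt_of_le_of_ne measureReal_nonneg h0.symm
  -- `m` is the conditional mean of `‖x‖²` on the ball, so that the radial function `f` below has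
  -- Gaussian integral 0. The function `h` selects the directions in which `G` reaches radius `√m`.
  set m : ℝ := (∫ x in B, ‖x‖ ^ 2 ∂γ) / γ.real B with hm
  have hm0 : 0 ≤ m := div_nonneg (integral_nonneg fun _ => by positivity) hBpos.le
  let f : ℝ → ℝ := fun r => if r ^ 2 ≤ δ then r ^ 2 - m else 0
  classical
  let h : E → ℝ := fun x => if (√m / ‖x‖) • x ∈ G then 1 else 0
  have hfB : (fun x : E => f ‖x‖) = B.indicator fun x => ‖x‖ ^ 2 - m := by
    ext x
    simp only [f, hB, Set.indicator, Set.mem_ofPred_eq]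
  have hfI : Integrable (fun x : E => f ‖x‖) γ := by
    rw [hfB]
    exact (hI.sub (integrable_const m)).indicator hBm
  have hf0 : ∫ x, f ‖x‖ ∂γ = 0 := by
    rw [hfB, integral_indicator hBm, integral_sub hI.integrableOn (integrable_const m).integrableOn,
      setIntegral_const, smul_eq_mul, hm]
    field_simp
    ring
  have hhom : ∀ r : ℝ, 0 < r → ∀ x, h (r • x) = h x := by
    intro r hr x
    have : (√m / ‖r • x‖) • r • x = (√m / ‖x‖) • x := by
      rw [norm_smul, smul_smul, Real.norm_of_nonneg hr.le]
      congr 1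
      field_simp
    simp only [h, this]
  have hhm : Measurable h := by
    refine Measurable.ite ?_ measurable_const measurable_const
    have : Measurable fun x : E => (√m / ‖x‖) • x := by fun_prop
    exact this hG
  have hz := integral_stdGaussian_radial_mul_homogeneous_eq_zero f h hhom hf0
  have hint : Integrable (fun x : E => f ‖x‖ * h x) γ := by
    refine hfI.mul_bdd (c := 1) hhm.aestronglyMeasurable (.of_forall fun x => ?_)
    simp only [h]
    split_ifs <;> simp
  -- The inequality is pointwise. A point of `G` beyond radius `√m` has `h = 1` by shrinking, and a
  -- point of `G` with `h = 0` has a nonpositive integrand on the left. A point outside `G` with `h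
  -- = 1` lies at radius at least `√m`, since otherwise shrinking would put it in `G`; so `f ≥ 0`
  -- there.
  have hle : ∫ x in G, (‖x‖ ^ 2 - m) ∂γ ≤ ∫ x, f ‖x‖ * h x ∂γ := by
    rw [← integral_indicator hG]
    refine integral_mono ((hI.sub (integrable_const m)).indicator hG) hint fun x => ?_
    simp only [Set.indicator, f, h]
    by_cases hxG : x ∈ G
    · have hxB : ‖x‖ ^ 2 ≤ δ := hδ x hxG
      rw [if_pos hxG, if_pos hxB]
      split_ifs with hx
      · simp
      · rw [mul_zero]
        by_contra hlt
        push Not at hlt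
        have hmx : √m ≤ ‖x‖ := Real.sqrt_le_iff.2 ⟨norm_nonneg _, by linarith⟩
        exact hx (hstar x hxG _ (by positivity) (div_le_one_of_le₀ hmx (norm_nonneg _)))
    · rw [if_neg hxG]
      split_ifs with hx1 hx2 hx2
      · rw [mul_one]
        by_contra hlt
        push Not at hlt
        have hmx : ‖x‖ < √m := Real.lt_sqrt_of_sq_lt (by linarith)
        have := hstar _ hx2 (‖x‖ / √m) (by positivity)
          (div_le_one_of_le₀ hmx.le (Real.sqrt_nonneg _))
        refine hxG ?_
        rcases eq_or_ne x 0 with rfl | hx0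
        · simpa using hx2
        · have hn : ‖x‖ ≠ 0 := norm_ne_zero_iff.2 hx0
          have hm' : √m ≠ 0 := ((norm_nonneg x).trans_lt hmx).ne'
          rw [smul_smul] at this
          have h1 : ‖x‖ / √m * (√m / ‖x‖) = 1 := by field_simp
          rwa [h1, one_smul] at this
      all_goals simp
  rw [hz, integral_sub hI.integrableOn (integrable_const m).integrableOn, setIntegral_const,
    smul_eq_mul, sub_nonpos] at hle
  calc (∫ x in G, ‖x‖ ^ 2 ∂γ) * γ.real B ≤ (γ.real G * m) * γ.real B := by gcongr
    _ = _ := by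
      rw [hm]
      field_simp

/-- The law of `‖x‖²` under the standard Gaussian measure is a chi-squared law. -/
theorem map_norm_sq_stdGaussian :
    (stdGaussian E).map (fun x => ‖x‖ ^ 2) = chiSq (Module.finrank ℝ E) := by
  let e := (stdOrthonormalBasis ℝ E).repr
  rw [chiSq, ← stdGaussian_map e, Measure.map_map (by fun_prop) (by fun_prop)]
  congr 1
  ext x
  simp

end StdGaussian

/-! ### Second moment on a ball and the chi-squared law with two more degrees of freedom -/

theorem exists_integral_radial_stdGaussian (d : ℕ) :
    ∃ a : ℝ, ∀ f : ℝ → ℝ, ∫ x, f ‖x‖ ∂(stdGaussian (EuclideanSpace ℝ (Fin (d + 1)))) =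
      a * ∫ r in Set.Ioi (0 : ℝ), r ^ d * (Real.exp (-(1 / 2) * r ^ 2) * f r) := by
  refine ⟨(2 * Real.pi) ^ (-((d + 1 : ℕ) / 2 : ℝ)) * ((d + 1 : ℕ) *
    (volume : Measure (EuclideanSpace ℝ (Fin (d + 1)))).real (Metric.ball 0 1)), fun f => ?_⟩
  rw [integral_stdGaussian_eq, integral_fun_norm_addHaar (volume : Measure
      (EuclideanSpace ℝ (Fin (d + 1)))) (fun r => Real.exp (-(1 / 2) * r ^ 2) * f r)]
  simp only [finrank_euclideanSpace, Fintype.card_fin, Nat.add_sub_cancel, smul_eq_mul,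
    nsmul_eq_mul]
  ring

/-- The factor `r²` turns the radial weight `r ^ d` of dimension `d + 1` into that of dimension `d +
3`. The ratio of the two normalizing constants is found by testing on `f = 1`, where the left side
is `E‖x‖² = d + 1`. -/
theorem integral_norm_sq_mul_radial_stdGaussian (d : ℕ) (f : ℝ → ℝ) :
    ∫ x, ‖x‖ ^ 2 * f ‖x‖ ∂(stdGaussian (EuclideanSpace ℝ (Fin (d + 1)))) =
      (d + 1 : ℝ) * ∫ x, f ‖x‖ ∂(stdGaussian (EuclideanSpace ℝ (Fin (d + 1 + 2)))) := by
  obtain ⟨a, ha⟩ := exists_integral_radial_stdGaussian d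
  obtain ⟨b, hb⟩ := exists_integral_radial_stdGaussian (d + 2)
  have hshift : ∀ g : ℝ → ℝ, ∫ r in Set.Ioi (0 : ℝ), r ^ d *
      (Real.exp (-(1 / 2) * r ^ 2) * (r ^ 2 * g r)) =
      ∫ r in Set.Ioi (0 : ℝ), r ^ (d + 2) * (Real.exp (-(1 / 2) * r ^ 2) * g r) := fun g => by
    congr 1
    ext r
    ring
  have h1 := ha fun r => r ^ 2 * 1
  have h2 := hb fun _ => 1
  rw [hshift] at h1
  simp only [mul_one] at h1
  rw [integral_norm_sq_stdGaussian] at h1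
  simp only [finrank_euclideanSpace, Fintype.card_fin, mul_one, integral_const, probReal_univ,
    smul_eq_mul] at h1 h2
  rw [ha fun r => r ^ 2 * f r, hb, hshift, ← mul_assoc]
  congr 1
  push_cast at h1
  rw [h1]
  linear_combination (norm := ring_nf) a * h2

theorem setIntegral_norm_sq_stdGaussian_ball (d : ℕ) (δ : ℝ) :
    ∫ x in {x | ‖x‖ ^ 2 ≤ δ}, ‖x‖ ^ 2 ∂(stdGaussian (EuclideanSpace ℝ (Fin d))) =
      d * (chiSq (d + 2)).real (Set.Iic δ) := by
  cases d with
  | zero => simp [Subsingleton.elim _ (0 : EuclideanSpace ℝ (Fin 0))]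
  | succ d =>
    have hm : ∀ d : ℕ, MeasurableSet {x : EuclideanSpace ℝ (Fin d) | ‖x‖ ^ 2 ≤ δ} := fun d =>
      measurableSet_le (by fun_prop) (by fun_prop)
    have key := integral_norm_sq_mul_radial_stdGaussian d fun r => if r ^ 2 ≤ δ then 1 else 0
    have h1 : (fun x : EuclideanSpace ℝ (Fin (d + 1)) =>
        ‖x‖ ^ 2 * if ‖x‖ ^ 2 ≤ δ then (1 : ℝ) else 0) =
        {x | ‖x‖ ^ 2 ≤ δ}.indicator fun x => ‖x‖ ^ 2 := by
      ext x
      simp [Set.indicator]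
    have h2 : (fun x : EuclideanSpace ℝ (Fin (d + 1 + 2)) =>
        if ‖x‖ ^ 2 ≤ δ then (1 : ℝ) else 0) = {x | ‖x‖ ^ 2 ≤ δ}.indicator 1 := by
      ext x
      simp [Set.indicator]
    rw [h1, h2, integral_indicator (hm _), integral_indicator_one (hm _)] at key
    rw [key, chiSq, map_measureReal_apply (by fun_prop) measurableSet_Iic]
    push_cast
    rfl

section StdGaussian

variable {E : Type*} [NormedAddCommGroup E] [InnerProductSpace ℝ E] [FiniteDimensional ℝ E]
  [MeasurableSpace E] [BorelSpace E]

/-- Conditionally on a star-shaped event inside the ball `‖x‖² ≤ δ` of `ℝ^d`, the mean of `‖x‖²` is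
at most `d Pr(χ²_{d+2} ≤ δ) / Pr(χ²_d ≤ δ)`. -/
theorem setIntegral_norm_sq_stdGaussian_le_chiSq {G : Set E}
    (hG : MeasurableSet G) (hstar : ∀ x ∈ G, ∀ r : ℝ, 0 ≤ r → r ≤ 1 → r • x ∈ G) {δ : ℝ}
    (hδ : ∀ x ∈ G, ‖x‖ ^ 2 ≤ δ) :
    ∫ x in G, ‖x‖ ^ 2 ∂(stdGaussian E) ≤ Module.finrank ℝ E *
      ((chiSq (Module.finrank ℝ E + 2)).real (Set.Iic δ) /
        (chiSq (Module.finrank ℝ E)).real (Set.Iic δ)) * (stdGaussian E).real G := by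
  rcases subsingleton_or_nontrivial E with hE | hE
  -- Dimension 0 is treated apart because the polar decomposition needs a nontrivial space.
  · have : ∀ x : E, ‖x‖ ^ 2 = 0 := fun x => by simp [Subsingleton.elim x 0]
    simp_rw [this]
    rw [integral_zero]
    positivity
  have hBm : MeasurableSet {x : E | ‖x‖ ^ 2 ≤ δ} := measurableSet_le (by fun_prop) (by fun_prop)
  have h1 : (chiSq (Module.finrank ℝ E)).real (Set.Iic δ) =
      (stdGaussian E).real {x | ‖x‖ ^ 2 ≤ δ} := by
    rw [← map_norm_sq_stdGaussian, map_measureReal_apply (by fun_prop) measurableSet_Iic]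
    rfl
  have h2 : ∫ x in {x | ‖x‖ ^ 2 ≤ δ}, ‖x‖ ^ 2 ∂(stdGaussian E) =
      Module.finrank ℝ E * (chiSq (Module.finrank ℝ E + 2)).real (Set.Iic δ) := by
    let e := (stdOrthonormalBasis ℝ E).repr
    rw [← setIntegral_norm_sq_stdGaussian_ball, ← stdGaussian_map e,
      setIntegral_map (measurableSet_le (by fun_prop) (by fun_prop)) (by fun_prop) (by fun_prop)]
    simp
  have key := setIntegral_norm_sq_stdGaussian_starShaped_le hG hstar hδ
  rw [h2] at key
  rw [h1]
  rcases eq_or_ne ((stdGaussian E).real {x | ‖x‖ ^ 2 ≤ δ}) 0 with h0 | h0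
  -- A null ball makes the ratio a division by 0, with value 0; then `G` is null as well and both
  -- sides vanish.
  · have hGB : G ⊆ {x | ‖x‖ ^ 2 ≤ δ} := hδ
    have : (stdGaussian E) G = 0 := by
      rw [measureReal_eq_zero_iff] at h0
      exact measure_mono_null hGB h0
    rw [Measure.restrict_eq_zero.2 this]
    simp [h0]
  · rw [mul_div_assoc', div_mul_eq_mul_div, le_div_iff₀ (lt_of_le_of_ne measureReal_nonneg h0.symm)]
    exact key

end StdGaussian

/-! ### Block Gaussian vectors and sign symmetry -/

section Blocks

variable {ι F H : Type*} [Fintype ι] [NormedAddCommGroup F] [InnerProductSpace ℝ F]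
  [FiniteDimensional ℝ F] [MeasurableSpace F] [BorelSpace F]
  [NormedAddCommGroup H] [InnerProductSpace ℝ H]

/-- The law of a family of independent standard Gaussian vectors is standard Gaussian. -/
theorem map_toLp_pi_stdGaussian :
    (Measure.pi fun _ : ι => stdGaussian F).map (WithLp.toLp 2) =
      stdGaussian (PiLp 2 fun _ : ι => F) := by
  have : IsProbabilityMeasure ((Measure.pi fun _ : ι => stdGaussian F).map (WithLp.toLp 2)) :=
    Measure.isProbabilityMeasure_map (by fun_prop)
  refine Measure.ext_of_charFun (funext fun t => ?_)
  rw [charFun_pi, charFun_stdGaussian]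
  simp_rw [charFun_stdGaussian]
  rw [← Complex.exp_sum]
  congr 1
  rw [← Complex.ofReal_pow, PiLp.norm_sq_eq_of_L2, ← Finset.sum_div, Finset.sum_neg_distrib]
  push_cast
  rfl

/-- Changing the sign of one block. -/
def flipBlock [DecidableEq ι] (i : ι) : (PiLp 2 fun _ : ι => F) ≃ₗᵢ[ℝ] (PiLp 2 fun _ : ι => F) :=
  LinearIsometryEquiv.piLpCongrRight 2 fun j =>
    if j = i then LinearIsometryEquiv.neg ℝ else LinearIsometryEquiv.refl ℝ F

theorem flipBlock_apply_self [DecidableEq ι] (i : ι) (x : PiLp 2 fun _ : ι => F) :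
    flipBlock i x i = -x i := by
  simp [flipBlock]

theorem flipBlock_apply_of_ne [DecidableEq ι] {i j : ι} (h : j ≠ i) (x : PiLp 2 fun _ : ι => F) :
    flipBlock i x j = x j := by
  simp [flipBlock, h]

theorem norm_flipBlock_apply [DecidableEq ι] (i j : ι) (x : PiLp 2 fun _ : ι => F) :
    ‖flipBlock i x j‖ = ‖x j‖ := by
  by_cases h : j = i
  · subst h
    simp [flipBlock_apply_self]
  · rw [flipBlock_apply_of_ne h]

variable {G : Set (PiLp 2 fun _ : ι => F)}

theorem integrable_inner_blocks (B : ι → F →L[ℝ] H) (i j : ι) :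
    Integrable (fun x => inner ℝ (B i (x i)) (B j (x j))) (stdGaussian (PiLp 2 fun _ : ι => F)) := by
  have h : ∀ i, MemLp (fun x : PiLp 2 fun _ : ι => F => B i (x i)) 2
      (stdGaussian (PiLp 2 fun _ : ι => F)) := fun i =>
    ((B i).comp (PiLp.proj 2 (𝕜 := ℝ) (fun _ : ι => F) i)).comp_memLp' IsGaussian.memLp_two_id
  refine Integrable.mono' (((h i).norm.integrable_mul (h j).norm)) ?_ (.of_forall fun x => ?_)
  · exact (h i).1.inner (h j).1
  · exact norm_inner_le_norm _ _

/-- Flipping the sign of block `i` preserves the Gaussian law and the solid set `G` but negates the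
integrand. -/
theorem setIntegral_inner_blocks_eq_zero (hG : MeasurableSet G)
    (hsolid : ∀ x ∈ G, ∀ y : PiLp 2 fun _ : ι => F, (∀ i, ‖y i‖ ≤ ‖x i‖) → y ∈ G)
    (B : ι → F →L[ℝ] H) {i j : ι} (hij : i ≠ j) :
    ∫ x in G, inner ℝ (B i (x i)) (B j (x j)) ∂(stdGaussian (PiLp 2 fun _ : ι => F)) = 0 := by
  classical
  set I := ∫ x in G, inner ℝ (B i (x i)) (B j (x j)) ∂(stdGaussian (PiLp 2 fun _ : ι => F)) with hI
  have hpre : flipBlock i ⁻¹' G = G := by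
    ext x
    refine ⟨fun h => hsolid _ h _ fun l => ?_, fun h => hsolid _ h _ fun l => ?_⟩ <;>
    rw [norm_flipBlock_apply]
  have h1 : I = ∫ x in G, inner ℝ (B i (flipBlock i x i)) (B j (flipBlock i x j))
      ∂(stdGaussian (PiLp 2 fun _ : ι => F)) := by
    rw [hI]
    conv_lhs => rw [← stdGaussian_map (flipBlock (F := F) i)]
    rw [setIntegral_map hG _ (by fun_prop), hpre]
    rw [stdGaussian_map]
    exact (integrable_inner_blocks B i j).1
  have h2 : I = -I := by
    conv_lhs => rw [h1]
    rw [hI, ← integral_neg]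
    congr 1
    ext x
    rw [flipBlock_apply_self, flipBlock_apply_of_ne hij.symm, map_neg, inner_neg_left]
  linarith

theorem setIntegral_norm_sq_sum_blocks_le (hG : MeasurableSet G)
    (hsolid : ∀ x ∈ G, ∀ y : PiLp 2 fun _ : ι => F, (∀ i, ‖y i‖ ≤ ‖x i‖) → y ∈ G)
    (B : ι → F →L[ℝ] H) {c : ℝ} (hB : ∀ i v, ‖B i v‖ ^ 2 ≤ c * ‖v‖ ^ 2) :
    ∫ x in G, ‖∑ i, B i (x i)‖ ^ 2 ∂(stdGaussian (PiLp 2 fun _ : ι => F)) ≤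
      c * ∫ x in G, ‖x‖ ^ 2 ∂(stdGaussian (PiLp 2 fun _ : ι => F)) := by
  have h1 : ∀ x : PiLp 2 fun _ : ι => F, ‖∑ i, B i (x i)‖ ^ 2 =
      ∑ i, ∑ j, inner ℝ (B i (x i)) (B j (x j)) := fun x => by
    rw [← real_inner_self_eq_norm_sq, sum_inner]
    simp_rw [inner_sum]
  simp_rw [h1]
  rw [integral_finsetSum _ fun i _ => integrable_finsetSum _ fun j _ =>
    (integrable_inner_blocks B i j).integrableOn]
  have h2 : ∀ i, ∫ x in G, ∑ j, inner ℝ (B i (x i)) (B j (x j))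
      ∂(stdGaussian (PiLp 2 fun _ : ι => F)) =
      ∫ x in G, ‖B i (x i)‖ ^ 2 ∂(stdGaussian (PiLp 2 fun _ : ι => F)) := by
    intro i
    rw [integral_finsetSum _ fun j _ => (integrable_inner_blocks B i j).integrableOn,
      Finset.sum_eq_single i (fun j _ hj => setIntegral_inner_blocks_eq_zero hG hsolid B hj.symm)
        (by simp)]
    simp_rw [real_inner_self_eq_norm_sq]
  simp_rw [h2]
  have h3 : ∀ i, Integrable (fun x => ‖B i (x i)‖ ^ 2) (stdGaussian (PiLp 2 fun _ : ι => F)) :=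
    fun i => by
      simpa only [real_inner_self_eq_norm_sq] using integrable_inner_blocks B i i
  rw [← integral_finsetSum _ fun i _ => (h3 i).integrableOn, ← integral_const_mul]
  refine integral_mono (integrable_finsetSum _ fun i _ => (h3 i).integrableOn)
    (integrable_norm_sq_stdGaussian.const_mul c).integrableOn fun x => ?_
  simp only
  rw [PiLp.norm_sq_eq_of_L2, Finset.mul_sum]
  exact Finset.sum_le_sum fun i _ => hB i _

end Blocks

theorem setIntegral_norm_sq_sum_blocks_le_chiSqRatio {H : Type*} [NormedAddCommGroup H]
    [InnerProductSpace ℝ H] {τ q : ℕ} {G : Set (PiLp 2 fun _ : Fin τ => EuclideanSpace ℝ (Fin q))}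
    (hG : MeasurableSet G)
    (hsolid : ∀ x ∈ G, ∀ y : PiLp 2 fun _ : Fin τ => EuclideanSpace ℝ (Fin q),
      (∀ i, ‖y i‖ ≤ ‖x i‖) → y ∈ G)
    {δ : ℝ} (hδ : ∀ x ∈ G, ‖x‖ ^ 2 ≤ δ)
    (B : Fin τ → EuclideanSpace ℝ (Fin q) →L[ℝ] H) {c : ℝ}
    (hB : ∀ i v, ‖B i v‖ ^ 2 ≤ c * ‖v‖ ^ 2) :
    ∫ x in G, ‖∑ i, B i (x i)‖ ^ 2
        ∂(stdGaussian (PiLp 2 fun _ : Fin τ => EuclideanSpace ℝ (Fin q))) ≤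
      τ * q * chiSqRatio q τ δ * c *
        (stdGaussian (PiLp 2 fun _ : Fin τ => EuclideanSpace ℝ (Fin q))).real G := by
  have h1 := setIntegral_norm_sq_sum_blocks_le hG hsolid B hB
  have hd : Module.finrank ℝ (PiLp 2 fun _ : Fin τ => EuclideanSpace ℝ (Fin q)) = τ * q := by
    rw [LinearEquiv.finrank_eq (WithLp.linearEquiv 2 ℝ (Fin τ → EuclideanSpace ℝ (Fin q)))]
    simp [Module.finrank_pi_fintype]
  have h2 := setIntegral_norm_sq_stdGaussian_le_chiSq hG (fun x hx r h0 hr => hsolid x hx _ fun i =>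
    by
      rw [PiLp.smul_apply, norm_smul, Real.norm_of_nonneg h0]
      exact mul_le_of_le_one_left (norm_nonneg _) hr) hδ
  rw [hd] at h2
  push_cast at h2
  -- When `τ q = 0` there is no unit vector to show `0 ≤ c`, but both sides vanish.
  rcases Nat.eq_zero_or_pos (τ * q) with h0 | h0
  · have h3 : ((τ : ℝ) * q) = 0 := by exact_mod_cast h0
    rw [h3] at h2 ⊢
    have h4 : 0 ≤ ∫ x in G, ‖x‖ ^ 2
      ∂(stdGaussian (PiLp 2 fun _ : Fin τ => EuclideanSpace ℝ (Fin q))) :=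
      integral_nonneg fun _ => by positivity
    have h5 : ∫ x in G, ‖x‖ ^ 2
      ∂(stdGaussian (PiLp 2 fun _ : Fin τ => EuclideanSpace ℝ (Fin q))) = 0 :=
      le_antisymm (by simpa using h2) h4
    rw [h5] at h1
    simpa using h1
  · have hc : 0 ≤ c := by
      have := hB ⟨0, Nat.pos_of_mul_pos_right h0⟩
        (EuclideanSpace.single ⟨0, Nat.pos_of_mul_pos_left h0⟩ 1)
      simp only [PiLp.norm_single, norm_one, one_pow, mul_one] at this
      exact (sq_nonneg _).trans this
    refine h1.trans ((mul_le_mul_of_nonneg_left h2 hc).trans_eq ?_)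
    rw [chiSqRatio]
    ring

/-! ### Quadratic forms, maximum eigenvalue, rank -/

section LinearAlgebra

variable {ι κ : Type*} [Fintype ι] [Fintype κ] [DecidableEq ι] [DecidableEq κ]

theorem inner_toLpLin_left (L : Matrix κ ι ℝ) (x : EuclideanSpace ℝ ι) (t : EuclideanSpace ℝ κ) :
    inner ℝ (Matrix.toLpLin 2 2 L x) t = inner ℝ x (Matrix.toLpLin 2 2 Lᵀ t) := by
  simp only [EuclideanSpace.inner_eq_star_dotProduct, Matrix.toLpLin_apply, star_trivial]
  rw [dotProduct_comm, ← Matrix.vecMul_transpose, ← Matrix.dotProduct_mulVec, dotProduct_comm]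

theorem norm_sq_toLpLin (L : Matrix κ ι ℝ) (x : EuclideanSpace ℝ ι) :
    ‖Matrix.toLpLin 2 2 L x‖ ^ 2 = inner ℝ x (Matrix.toLpLin 2 2 (Lᵀ * L) x) := by
  rw [← real_inner_self_eq_norm_sq, inner_toLpLin_left, Matrix.toLpLin_mul_same]
  rfl

theorem continuous_toLpLin (L : Matrix κ ι ℝ) : Continuous (Matrix.toLpLin 2 2 L) :=
  LinearMap.continuous_of_finiteDimensional _

/-- The quadratic form of a symmetric matrix is bounded by its maximum eigenvalue. -/
theorem inner_toLpLin_le_lambdaMax {M : Matrix ι ι ℝ} (hM : M.IsHermitian)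
    (x : EuclideanSpace ℝ ι) :
    inner ℝ x (Matrix.toLpLin 2 2 M x) ≤ lambdaMax M * ‖x‖ ^ 2 := by
  have hfin : (spectrum ℝ M).Finite := by
    rw [hM.spectrum_real_eq_range_eigenvalues]
    exact Set.finite_range _
  have hps : (algebraMap ℝ (Matrix ι ι ℝ) (lambdaMax M) - M).PosSemidef := by
    rw [Matrix.posSemidef_iff_isHermitian_and_spectrum_nonneg]
    refine ⟨?_, ?_⟩
    · refine Matrix.IsHermitian.sub ?_ hM
      rw [Matrix.algebraMap_eq_diagonal]
      exact Matrix.isHermitian_diagonal _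
    · intro r hr
      rw [← spectrum.singleton_sub_eq] at hr
      obtain ⟨a, ha, b, hb, rfl⟩ := Set.mem_sub.1 hr
      rw [Set.mem_singleton_iff] at ha
      subst ha
      have := le_csSup hfin.bddAbove hb
      simpa [lambdaMax] using this
  have h := hps.dotProduct_mulVec_nonneg x.ofLp
  rw [Matrix.sub_mulVec, dotProduct_sub, sub_nonneg] at h
  rw [EuclideanSpace.inner_eq_star_dotProduct, Matrix.toLpLin_apply, dotProduct_comm]
  refine h.trans_eq ?_
  rw [Algebra.algebraMap_eq_smul_one, Matrix.smul_mulVec, Matrix.one_mulVec, dotProduct_smul,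
    ← real_inner_self_eq_norm_sq, EuclideanSpace.inner_eq_star_dotProduct]
  rfl

/-- `‖B v‖² ≤ c ‖v‖²` as soon as the quadratic form of `B Bᵀ` is bounded by `c`. -/
theorem norm_sq_toLpLin_le {B : Matrix κ ι ℝ} {c : ℝ} (hc : 0 ≤ c)
    (h : ∀ u : EuclideanSpace ℝ κ, inner ℝ u (Matrix.toLpLin 2 2 (B * Bᵀ) u) ≤ c * ‖u‖ ^ 2)
    (v : EuclideanSpace ℝ ι) : ‖Matrix.toLpLin 2 2 B v‖ ^ 2 ≤ c * ‖v‖ ^ 2 := by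
  set u := Matrix.toLpLin 2 2 B v with hu
  rcases eq_or_ne u 0 with h0 | h0
  · rw [h0]
    simpa using mul_nonneg hc (sq_nonneg _)
  have hu0 : 0 < ‖u‖ := norm_pos_iff.2 h0
  have h1 : ‖Matrix.toLpLin 2 2 Bᵀ u‖ ^ 2 ≤ c * ‖u‖ ^ 2 := by
    have := norm_sq_toLpLin Bᵀ u
    rw [Matrix.transpose_transpose] at this
    exact this.trans_le (h u)
  -- Cauchy–Schwarz on `⟪B v, u⟫ = ⟪v, Bᵀ u⟫` transfers the bound from `Bᵀ` to `B`.
  have h2 : ‖u‖ ^ 2 ≤ ‖v‖ * ‖Matrix.toLpLin 2 2 Bᵀ u‖ := by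
    rw [← real_inner_self_eq_norm_sq]
    conv_lhs => rw [hu]
    rw [inner_toLpLin_left]
    exact real_inner_le_norm _ _
  have h3 : (‖u‖ ^ 2) ^ 2 ≤ ‖v‖ ^ 2 * (c * ‖u‖ ^ 2) := by
    calc (‖u‖ ^ 2) ^ 2 ≤ (‖v‖ * ‖Matrix.toLpLin 2 2 Bᵀ u‖) ^ 2 := by gcongr
      _ = ‖v‖ ^ 2 * ‖Matrix.toLpLin 2 2 Bᵀ u‖ ^ 2 := by ring
      _ ≤ _ := by gcongr
  have h4 : 0 < ‖u‖ ^ 2 := by positivity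
  nlinarith

theorem lambdaMax_nonneg {M : Matrix ι ι ℝ} (hM : M.PosSemidef) : 0 ≤ lambdaMax M :=
  Real.sSup_nonneg fun _ hr => (Matrix.posSemidef_iff_isHermitian_and_spectrum_nonneg.1 hM).2 hr

open scoped MatrixOrder Matrix.Norms.L2Operator in
theorem Matrix.PosDef.rank_transpose_mul_mul {S : Matrix κ κ ℝ} (hS : S.PosDef)
    (B : Matrix κ ι ℝ) : (Bᵀ * S * B).rank = B.rank := by
  obtain ⟨y, hy, rfl⟩ := CStarAlgebra.isStrictlyPositive_iff_eq_star_mul_self.mp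
    hS.isStrictlyPositive
  have h1 : Bᵀ * (star y * y) * B = (y * B)ᵀ * (y * B) := by
    rw [Matrix.star_eq_conjTranspose, Matrix.conjTranspose_eq_transpose_of_trivial,
      Matrix.transpose_mul]
    simp only [Matrix.mul_assoc]
  rw [h1, Matrix.rank_transpose_mul_self, Matrix.rank_mul_eq_right_of_isUnit_det]
  exact (Matrix.isUnit_iff_isUnit_det _).1 hy

end LinearAlgebra

/-! ### Whitening by an ordered eigendecomposition -/

section Eigendecomposition

variable {n : ℕ} {M U : Matrix (Fin n) (Fin n) ℝ} {D : Fin n → ℝ}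

theorem IsOrderedEigendecomposition.eq_mul (h : IsOrderedEigendecomposition M U D) :
    M = U * Matrix.diagonal D * Uᵀ := by
  have hU : U * Uᵀ = 1 := (Matrix.mem_orthogonalGroup_iff _ _).1 h.orthogonal
  rw [← h.diagonal]
  simp only [← Matrix.mul_assoc, hU, Matrix.one_mul]
  rw [Matrix.mul_assoc, hU, Matrix.mul_one]

theorem IsOrderedEigendecomposition.transpose_mul_self (h : IsOrderedEigendecomposition M U D) :
    Uᵀ * U = 1 :=
  (Matrix.mem_orthogonalGroup_iff' _ _).1 h.orthogonal

theorem IsOrderedEigendecomposition.nonneg (h : IsOrderedEigendecomposition M U D)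
    (hM : M.PosSemidef) (i : Fin n) : 0 ≤ D i := by
  have := hM.conjTranspose_mul_mul_same U
  rw [Matrix.conjTranspose_eq_transpose_of_trivial, h.diagonal, Matrix.posSemidef_diagonal_iff]
    at this
  exact this i

/-- The positive eigenvalues of a positive semidefinite matrix are the first `rank M` ones. -/
theorem IsOrderedEigendecomposition.pos_iff (h : IsOrderedEigendecomposition M U D)
    (hM : M.PosSemidef) (i : Fin n) : 0 < D i ↔ (i : ℕ) < M.rank := by
  have hdet : IsUnit U.det := by
    have h1 := congrArg Matrix.det h.transpose_mul_self
    rw [Matrix.det_mul, Matrix.det_one] at h1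
    exact IsUnit.of_mul_eq_one_right _ h1
  have hrank : M.rank = (Matrix.diagonal D).rank := by
    rw [h.eq_mul, Matrix.rank_mul_eq_left_of_isUnit_det _ _ (by rwa [Matrix.det_transpose]),
      Matrix.rank_mul_eq_right_of_isUnit_det _ _ hdet]
  classical
  set s : Finset (Fin n) := Finset.univ.filter fun i => 0 < D i with hs
  have hcard : s.card = M.rank := by
    rw [hrank, Matrix.rank_diagonal, Fintype.card_subtype]
    congr 1
    ext i
    simp only [hs, Finset.mem_filter]
    exact and_congr_right fun _ => (h.nonneg hM i).lt_iff_ne'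
  set t : Finset (Fin n) := Finset.univ.filter fun i => (i : ℕ) < M.rank with ht
  -- The positive indices form an initial segment of cardinality `rank M`, so a positive index `i`
  -- satisfies `i + 1 ≤ rank M`; counting then gives equality.
  have hst : s ⊆ t := by
    intro i hi
    have hi' : 0 < D i := (Finset.mem_filter.1 hi).2
    have hsub : Finset.Iic i ⊆ s := fun j hj =>
      Finset.mem_filter.2 ⟨Finset.mem_univ _, h.positive_first j i (Finset.mem_Iic.1 hj) hi'⟩
    have := Finset.card_le_card hsub
    rw [Fin.card_Iic, hcard] at this
    exact Finset.mem_filter.2 ⟨Finset.mem_univ _, this⟩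
  have htc : t.card ≤ s.card := by
    rw [hcard]
    have : t.map Fin.valEmbedding ⊆ Finset.range M.rank := by
      intro j hj
      obtain ⟨i, hi, rfl⟩ := Finset.mem_map.1 hj
      exact Finset.mem_range.2 (Finset.mem_filter.1 hi).2
    simpa using Finset.card_le_card this
  have heq := Finset.eq_of_subset_of_card_le hst htc
  have := Finset.ext_iff.1 heq i
  simpa [hs, ht] using this

/-- The selection matrix `[Λ^{-1/2}, 0]`. -/
def selector (q : ℕ) (D : Fin n → ℝ) : Matrix (Fin q) (Fin n) ℝ :=
  Matrix.of fun i j => if (i : ℕ) = j then (√(D j))⁻¹ else 0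

theorem normalizer_eq (q : ℕ) : normalizer q U D = selector q D * Uᵀ := rfl

theorem normalizer_mul_mul_transpose (h : IsOrderedEigendecomposition M U D)
    (hM : M.PosSemidef) {q : ℕ} (hq : M.rank = q) :
    normalizer q U D * M * (normalizer q U D)ᵀ = 1 := by
  have h1 : normalizer q U D * M * (normalizer q U D)ᵀ =
      selector q D * Matrix.diagonal D * (selector q D)ᵀ := by
    rw [normalizer_eq, Matrix.transpose_mul, Matrix.transpose_transpose, ← h.diagonal]
    simp only [Matrix.mul_assoc]
  have hqn : q ≤ n := hq ▸ M.rank_le_width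
  rw [h1]
  ext i j
  rw [Matrix.mul_apply, Finset.sum_eq_single (⟨i, i.2.trans_le hqn⟩ : Fin n)]
  · have hpos : 0 < D ⟨i, i.2.trans_le hqn⟩ := (h.pos_iff hM _).2 (hq ▸ i.2)
    rw [Matrix.mul_diagonal, Matrix.transpose_apply, Matrix.one_apply]
    by_cases hij : i = j
    · subst hij
      simp only [selector, Matrix.of_apply, if_true]
      have := Real.sq_sqrt hpos.le
      have h0 : √(D ⟨i, i.2.trans_le hqn⟩) ≠ 0 := (Real.sqrt_pos.2 hpos).ne'
      field_simp
      exact this.symm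
    · have : (j : ℕ) ≠ i := fun h => hij (Fin.ext h.symm)
      simp [selector, hij, this]
  · intro l _ hl
    have : (i : ℕ) ≠ l := fun h => hl (Fin.ext h.symm)
    simp [Matrix.mul_diagonal, selector, this]
  · simp

/-- With `F` the normalizer, `Fᵀ F` is a generalized inverse of `M`. This makes `M Fᵀ` a left
inverse of `F` on the range of `M`, so normalization loses nothing. -/
theorem mul_normalizer_transpose_mul_mul (h : IsOrderedEigendecomposition M U D)
    (hM : M.PosSemidef) {q : ℕ} (hq : M.rank = q) :
    M * (normalizer q U D)ᵀ * normalizer q U D * M = M := by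
  have hU := h.transpose_mul_self
  have h1 : M * (normalizer q U D)ᵀ * normalizer q U D * M =
      U * (Matrix.diagonal D * ((selector q D)ᵀ * selector q D) * Matrix.diagonal D) * Uᵀ := by
    conv_lhs => rw [h.eq_mul]
    rw [normalizer_eq, Matrix.transpose_mul, Matrix.transpose_transpose]
    simp only [Matrix.mul_assoc]
    rw [← Matrix.mul_assoc Uᵀ U, hU, Matrix.one_mul, ← Matrix.mul_assoc Uᵀ U, hU, Matrix.one_mul]
  have h2 : Matrix.diagonal D * ((selector q D)ᵀ * selector q D) * Matrix.diagonal D =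
      Matrix.diagonal D := by
    ext i j
    rw [Matrix.mul_diagonal, Matrix.diagonal_mul, Matrix.mul_apply, Matrix.diagonal_apply]
    simp only [Matrix.transpose_apply, selector, Matrix.of_apply]
    by_cases hi : (i : ℕ) < q
    · have hpos : 0 < D i := (h.pos_iff hM _).2 (hq ▸ hi)
      have h0 : √(D i) ≠ 0 := (Real.sqrt_pos.2 hpos).ne'
      rw [Finset.sum_eq_single (⟨i, hi⟩ : Fin q)]
      · simp only [if_true]
        by_cases hij : i = j
        · subst hij
          have := Real.mul_self_sqrt hpos.le
          simp only [if_true]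
          field_simp
          nlinarith
        · have : (i : ℕ) ≠ j := fun h => hij (Fin.ext h)
          simp [hij, this]
      · intro l _ hl
        have : (l : ℕ) ≠ i := fun h => hl (Fin.ext h)
        simp [this]
      · simp
    · have hDi : D i = 0 := by
        refine le_antisymm (not_lt.1 fun h0 => hi ?_) (h.nonneg hM i)
        rw [← hq]
        exact (h.pos_iff hM i).1 h0
      rw [hDi]
      simp
  rw [h1, h2, ← h.eq_mul]

end Eigendecomposition

/-! ### Linear images, sums and moments of Gaussian vectors -/

section GaussianVectors

variable {Ω : Type*} [MeasurableSpace Ω] {μ : Measure Ω} [IsProbabilityMeasure μ]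
  {ι κ : Type*} [Fintype ι] [Fintype κ] [DecidableEq ι] [DecidableEq κ]
  {X Y : Ω → EuclideanSpace ℝ ι} {Sig Sig' : Matrix ι ι ℝ}

theorem hasLaw_toLpLin_multivariateGaussian (hX : HasLaw X (multivariateGaussian 0 Sig) μ)
    (hSig : Sig.PosSemidef) (L : Matrix κ ι ℝ) :
    HasLaw (fun ω => Matrix.toLpLin 2 2 L (X ω)) (multivariateGaussian 0 (L * Sig * Lᵀ)) μ := by
  have hL := continuous_toLpLin L
  refine HasLaw.fun_comp (Y := Matrix.toLpLin 2 2 L) (μ := multivariateGaussian 0 Sig)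
    ⟨hL.measurable.aemeasurable, ?_⟩ hX
  have : IsProbabilityMeasure ((multivariateGaussian 0 Sig).map (Matrix.toLpLin 2 2 L)) :=
    Measure.isProbabilityMeasure_map hL.measurable.aemeasurable
  have hLS : (L * Sig * Lᵀ).PosSemidef := hSig.mul_mul_conjTranspose_same L
  refine Measure.ext_of_charFun (funext fun t => ?_)
  rw [charFun_multivariateGaussian hLS, charFun_apply,
    integral_map hL.measurable.aemeasurable (by fun_prop)]
  simp_rw [inner_toLpLin_left]
  rw [← charFun_apply, charFun_multivariateGaussian hSig]
  simp only [inner_zero_right, Complex.ofReal_zero, zero_mul, zero_sub, Matrix.toLpLin_apply]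
  congr 4
  rw [← Matrix.mulVec_mulVec, ← Matrix.mulVec_mulVec, Matrix.dotProduct_mulVec _ L,
    ← Matrix.mulVec_transpose]

theorem hasLaw_add_multivariateGaussian (hX : HasLaw X (multivariateGaussian 0 Sig) μ)
    (hY : HasLaw Y (multivariateGaussian 0 Sig') μ) (hSig : Sig.PosSemidef)
    (hSig' : Sig'.PosSemidef) (hXY : IndepFun X Y μ) :
    HasLaw (fun ω => X ω + Y ω) (multivariateGaussian 0 (Sig + Sig')) μ := by
  have hm : AEMeasurable (fun ω => X ω + Y ω) μ := hX.aemeasurable.add hY.aemeasurable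
  refine ⟨hm, ?_⟩
  have : IsProbabilityMeasure (μ.map fun ω => X ω + Y ω) := Measure.isProbabilityMeasure_map hm
  refine Measure.ext_of_charFun ?_
  rw [hXY.charFun_map_fun_add_eq_mul hX.aemeasurable hY.aemeasurable, hX.map_eq, hY.map_eq]
  ext t
  rw [Pi.mul_apply, charFun_multivariateGaussian hSig, charFun_multivariateGaussian hSig',
    charFun_multivariateGaussian (hSig.add hSig'), ← Complex.exp_add, Matrix.add_mulVec,
    dotProduct_add]
  simp only [inner_zero_right, Complex.ofReal_zero, zero_mul, zero_sub]
  congr 1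
  push_cast
  ring

theorem memLp_two_of_hasLaw_multivariateGaussian {m : EuclideanSpace ℝ ι}
    (hX : HasLaw X (multivariateGaussian m Sig) μ) : MemLp X 2 μ := by
  have h := IsGaussian.memLp_two_id (μ := multivariateGaussian m Sig)
  rw [← hX.map_eq] at h
  exact (memLp_map_measure_iff (by fun_prop) hX.aemeasurable).1 h

theorem integral_of_hasLaw_multivariateGaussian {m : EuclideanSpace ℝ ι}
    (hX : HasLaw X (multivariateGaussian m Sig) μ) : ∫ ω, X ω ∂μ = m := by
  rw [hX.integral_eq, integral_id_multivariateGaussian]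

theorem covariance_inner_of_hasLaw_multivariateGaussian
    (hX : HasLaw X (multivariateGaussian 0 Sig) μ) (hSig : Sig.PosSemidef)
    (a b : EuclideanSpace ℝ ι) :
    cov[fun ω => inner ℝ a (X ω), fun ω => inner ℝ b (X ω); μ] = a ⬝ᵥ Sig *ᵥ b := by
  rw [← covarianceBilin_multivariateGaussian hSig (μ := 0) a b,
    covarianceBilin_apply_eq_cov IsGaussian.memLp_two_id,
    ← hX.covariance_fun_comp (by fun_prop) (by fun_prop)]

theorem integral_mul_of_hasLaw_multivariateGaussian
    (hX : HasLaw X (multivariateGaussian 0 Sig) μ) (hSig : Sig.PosSemidef) (i j : ι) :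
    ∫ ω, X ω i * X ω j ∂μ = Sig i j := by
  have h2 : ∀ i, MemLp (fun ω => X ω i) 2 μ := fun i =>
    (EuclideanSpace.proj (𝕜 := ℝ) i).comp_memLp' (memLp_two_of_hasLaw_multivariateGaussian hX)
  have h0 : ∀ i, ∫ ω, X ω i ∂μ = 0 := fun i => by
    have := (EuclideanSpace.proj (𝕜 := ℝ) i).integral_comp_comm
      ((memLp_two_of_hasLaw_multivariateGaussian hX).integrable (by norm_num))
    rw [integral_of_hasLaw_multivariateGaussian hX] at this
    simpa using this
  have h := hX.covariance_fun_comp (f := fun x => x i) (g := fun x => x j) (by fun_prop)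
    (by fun_prop)
  rw [covariance_eval_multivariateGaussian hSig, covariance_eq_sub (h2 i) (h2 j), h0, zero_mul,
    sub_zero] at h
  exact h

theorem ae_eq_zero_of_hasLaw_multivariateGaussian_zero
    (hX : HasLaw X (multivariateGaussian 0 0) μ) : X =ᵐ[μ] 0 := by
  have h : multivariateGaussian (0 : EuclideanSpace ℝ ι) 0 = Measure.dirac 0 := by
    simp [multivariateGaussian]
  rw [h] at hX
  refine (hX.ae_iff (p := fun x => x = 0) ?_).2 ?_
  · exact measurableSet_setOfPred.1 (measurableSet_singleton (0 : EuclideanSpace ℝ ι))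
  · simp [ae_dirac_eq]

/-- The estimation error after a linear measurement is independent of the innovation. -/
theorem indepFun_error_innovation {e : Ω → EuclideanSpace ℝ ι} {v : Ω → EuclideanSpace ℝ κ}
    {P : Matrix ι ι ℝ} {R : Matrix κ κ ℝ} (hP : P.PosSemidef) (hR : R.PosSemidef)
    (he : HasLaw e (multivariateGaussian 0 P) μ) (hv : HasLaw v (multivariateGaussian 0 R) μ)
    (hev : IndepFun e v μ) (C : Matrix κ ι ℝ) (K : Matrix ι κ ℝ)
    (hK : K * (C * P * Cᵀ + R) = P * Cᵀ) :
    IndepFun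
      (fun ω => e ω - Matrix.toLpLin 2 2 K (Matrix.toLpLin 2 2 C (e ω) + v ω))
      (fun ω => Matrix.toLpLin 2 2 C (e ω) + v ω) μ := by
  have hge : HasGaussianLaw e μ := ⟨by rw [he.map_eq]; infer_instance⟩
  have hgv : HasGaussianLaw v μ := ⟨by rw [hv.map_eq]; infer_instance⟩
  have hg := hev.hasGaussianLaw hge hgv
  let Cc := LinearMap.toContinuousLinearMap (Matrix.toLpLin 2 2 C)
  let Kc := LinearMap.toContinuousLinearMap (Matrix.toLpLin 2 2 K)
  let y := Cc.comp (ContinuousLinearMap.fst ℝ (EuclideanSpace ℝ ι) (EuclideanSpace ℝ κ)) +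
    ContinuousLinearMap.snd ℝ (EuclideanSpace ℝ ι) (EuclideanSpace ℝ κ)
  let T := (ContinuousLinearMap.fst ℝ (EuclideanSpace ℝ ι) (EuclideanSpace ℝ κ) - Kc.comp y).prod y
  have hgT := hg.map T
  -- Error and innovation are jointly Gaussian, so independence reduces to zero covariance, which is
  -- the normal equation `hK` for the gain.
  refine HasGaussianLaw.indepFun_of_covariance_inner (X := fun ω => e ω - Matrix.toLpLin 2 2 K
    (Matrix.toLpLin 2 2 C (e ω) + v ω)) (Y := fun ω => Matrix.toLpLin 2 2 C (e ω) + v ω) hgT ?_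
  intro a b
  set a' := Matrix.toLpLin 2 2 Kᵀ a with ha'
  have h1 : ∀ ω, inner ℝ a (e ω - Matrix.toLpLin 2 2 K (Matrix.toLpLin 2 2 C (e ω) + v ω)) =
      inner ℝ (a - Matrix.toLpLin 2 2 Cᵀ a') (e ω) - inner ℝ a' (v ω) := by
    intro ω
    rw [inner_sub_right, real_inner_comm, real_inner_comm _ a, inner_toLpLin_left, ← ha',
      inner_add_left, inner_toLpLin_left, inner_sub_left, real_inner_comm a, real_inner_comm a',
      real_inner_comm (Matrix.toLpLin 2 2 Cᵀ a')]
    ring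
  have h2 : ∀ ω, inner ℝ b (Matrix.toLpLin 2 2 C (e ω) + v ω) =
      inner ℝ (Matrix.toLpLin 2 2 Cᵀ b) (e ω) + inner ℝ b (v ω) := by
    intro ω
    rw [inner_add_right, real_inner_comm, inner_toLpLin_left, real_inner_comm]
  simp_rw [h1, h2]
  have m1 : ∀ a : EuclideanSpace ℝ ι, MemLp (fun ω => inner ℝ a (e ω)) 2 μ := fun a =>
    (innerSL ℝ a).comp_memLp' hge.memLp_two
  have m2 : ∀ b : EuclideanSpace ℝ κ, MemLp (fun ω => inner ℝ b (v ω)) 2 μ := fun b =>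
    (innerSL ℝ b).comp_memLp' hgv.memLp_two
  have h0 : ∀ (a : EuclideanSpace ℝ ι) (b : EuclideanSpace ℝ κ),
      cov[fun ω => inner ℝ a (e ω), fun ω => inner ℝ b (v ω); μ] = 0 := fun a b =>
    (hev.comp (φ := fun x => inner ℝ a x) (ψ := fun x => inner ℝ b x) (by fun_prop)
      (by fun_prop)).covariance_eq_zero (m1 a) (m2 b)
  have h0' : ∀ (a : EuclideanSpace ℝ ι) (b : EuclideanSpace ℝ κ),
      cov[fun ω => inner ℝ b (v ω), fun ω => inner ℝ a (e ω); μ] = 0 := fun a b => by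
    rw [covariance_comm, h0]
  have m3 : MemLp (fun ω => inner ℝ (Matrix.toLpLin 2 2 Cᵀ b) (e ω) + inner ℝ b (v ω)) 2 μ :=
    (m1 _).add (m2 _)
  have hadd : ∀ Z : Ω → ℝ, MemLp Z 2 μ →
      cov[Z, fun ω => inner ℝ (Matrix.toLpLin 2 2 Cᵀ b) (e ω) + inner ℝ b (v ω); μ] =
      cov[Z, fun ω => inner ℝ (Matrix.toLpLin 2 2 Cᵀ b) (e ω); μ] +
        cov[Z, fun ω => inner ℝ b (v ω); μ] := fun Z hZ =>
    covariance_add_right hZ (m1 _) (m2 _)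
  rw [covariance_fun_sub_left (m1 _) (m2 _) m3,
    hadd _ (m1 _), hadd _ (m2 _), h0, h0', covariance_inner_of_hasLaw_multivariateGaussian he hP,
    covariance_inner_of_hasLaw_multivariateGaussian hv hR]
  simp only [ha', Matrix.toLpLin_apply, WithLp.ofLp_sub, add_zero, zero_add]
  have h3 : a.ofLp ⬝ᵥ (K * (C * P * Cᵀ + R)) *ᵥ b.ofLp = a.ofLp ⬝ᵥ (P * Cᵀ) *ᵥ b.ofLp := by
    rw [hK]
  rw [Matrix.mul_add, Matrix.add_mulVec, dotProduct_add] at h3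
  have h4 : (Cᵀ *ᵥ (Kᵀ *ᵥ a.ofLp)) ⬝ᵥ P *ᵥ (Cᵀ *ᵥ b.ofLp) =
      a.ofLp ⬝ᵥ (K * (C * P * Cᵀ)) *ᵥ b.ofLp := by
    rw [Matrix.mulVec_transpose, Matrix.mulVec_transpose, ← Matrix.dotProduct_mulVec,
      ← Matrix.dotProduct_mulVec]
    simp only [Matrix.mulVec_mulVec, Matrix.mul_assoc]
  have h5 : (Kᵀ *ᵥ a.ofLp) ⬝ᵥ R *ᵥ b.ofLp = a.ofLp ⬝ᵥ (K * R) *ᵥ b.ofLp := by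
    rw [Matrix.mulVec_transpose, ← Matrix.dotProduct_mulVec, Matrix.mulVec_mulVec]
  rw [sub_dotProduct, h4, h5, Matrix.mulVec_mulVec, ← h3]
  ring

end GaussianVectors

/-! ### Independence of σ-algebras and conditional expectations -/

section Independence

variable {Ω : Type*} {m0 : MeasurableSpace Ω} {μ : Measure Ω}

/-- The σ-algebra generated by a random variable. -/
abbrev sigmaOf {α : Type*} [MeasurableSpace α] (X : Ω → α) : MeasurableSpace Ω :=
  MeasurableSpace.comap X inferInstance

theorem measurable_sigmaOf {α : Type*} [MeasurableSpace α] (X : Ω → α) :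
    Measurable[sigmaOf X] X := comap_measurable X

/-- The probability of a triple intersection factors, and the sets `a ∩ b` form a π-system
generating `m₂ ⊔ m₃`. This is the tool for adding sources of randomness one at a time. -/
theorem indep_sup_of_indep_sup [IsProbabilityMeasure μ] {m₁ m₂ m₃ : MeasurableSpace Ω}
    (h₁ : m₁ ≤ m0) (h₂ : m₂ ≤ m0) (h₃ : m₃ ≤ m0) (h12 : Indep m₁ m₂ μ)
    (h123 : Indep (m₁ ⊔ m₂) m₃ μ) : Indep m₁ (m₂ ⊔ m₃) μ := by
  let p : Set (Set Ω) := {s | ∃ a b, MeasurableSet[m₂] a ∧ MeasurableSet[m₃] b ∧ a ∩ b = s}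
  have hp : IsPiSystem p := by
    rintro _ ⟨a, b, ha, hb, rfl⟩ _ ⟨a', b', ha', hb', rfl⟩ _
    exact ⟨a ∩ a', b ∩ b', ha.inter ha', hb.inter hb', Set.inter_inter_inter_comm _ _ _ _⟩
  have hgen : m₂ ⊔ m₃ = MeasurableSpace.generateFrom p := by
    refine le_antisymm (sup_le (fun s hs => ?_) fun s hs => ?_)
      (MeasurableSpace.generateFrom_le ?_)
    · exact MeasurableSpace.measurableSet_generateFrom
        ⟨s, Set.univ, hs, MeasurableSet.univ, Set.inter_univ s⟩
    · exact MeasurableSpace.measurableSet_generateFrom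
        ⟨Set.univ, s, MeasurableSet.univ, hs, Set.univ_inter s⟩
    · rintro _ ⟨a, b, ha, hb, rfl⟩
      exact MeasurableSet.inter (le_sup_left (a := m₂) (b := m₃) _ ha)
        (le_sup_right (a := m₂) (b := m₃) _ hb)
  refine IndepSets.indep h₁ (sup_le h₂ h₃) (p1 := {s | MeasurableSet[m₁] s})
    (@MeasurableSpace.isPiSystem_measurableSet Ω m₁) hp
    (@MeasurableSpace.generateFrom_measurableSet Ω m₁).symm hgen ?_
  rw [IndepSets_iff]
  rintro s _ hs ⟨a, b, ha, hb, rfl⟩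
  rw [Indep_iff] at h12 h123
  have hs' : MeasurableSet[m₁ ⊔ m₂] s := le_sup_left (a := m₁) (b := m₂) _ hs
  have ha' : MeasurableSet[m₁ ⊔ m₂] a := le_sup_right (a := m₁) (b := m₂) _ ha
  rw [← Set.inter_assoc, h123 _ _ (hs'.inter ha') hb, h12 _ _ hs ha, h123 _ _ ha' hb, mul_assoc]

theorem indep_sigmaOf_congr {α : Type*} [MeasurableSpace α] {X Y : Ω → α} {m : MeasurableSpace Ω}
    (hXY : X =ᵐ[μ] Y) (h : Indep (sigmaOf X) m μ) : Indep (sigmaOf Y) m μ := by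
  rw [Indep_iff] at h ⊢
  rintro _ t ⟨B, hB, rfl⟩ ht
  have h1 : (X ⁻¹' B : Set Ω) =ᵐ[μ] (Y ⁻¹' B : Set Ω) := by
    refine Filter.eventuallyEq_set.2 ?_
    filter_upwards [hXY] with ω hω
    rw [Set.mem_preimage, Set.mem_preimage, hω]
  have h2 : (X ⁻¹' B ∩ t : Set Ω) =ᵐ[μ] (Y ⁻¹' B ∩ t : Set Ω) :=
    ae_eq_set_inter h1 (ae_eq_refl t)
  rw [← measure_congr h1, ← measure_congr h2]
  exact h _ t ⟨B, hB, rfl⟩ ht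

/-- Characterizes the conditional mean by its residual, so the Kalman estimates can be verified
without computing conditional laws. -/
theorem condExp_eq_of_indep_sub {Ω E : Type*} {m m0 : MeasurableSpace Ω} {μ : Measure Ω}
    [IsProbabilityMeasure μ] [NormedAddCommGroup E]
    [NormedSpace ℝ E] [CompleteSpace E] [MeasurableSpace E] [BorelSpace E]
    [SecondCountableTopology E] (hm : m ≤ m0) {X Y : Ω → E}
    (hX : Integrable X μ) (hY : Integrable Y μ) (hXm : Measurable X) (hYm : Measurable[m] Y)
    (hind : Indep (sigmaOf fun ω => X ω - Y ω) m μ) (h0 : ∫ ω, (X ω - Y ω) ∂μ = 0) :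
    μ[X | m] =ᵐ[μ] Y := by
  have hYs : StronglyMeasurable[m] Y := hYm.stronglyMeasurable
  have hdm : Measurable fun ω => X ω - Y ω := hXm.sub (hYm.mono hm le_rfl)
  have h1 := condExp_indep_eq hdm.comap_le hm
    (measurable_sigmaOf fun ω => X ω - Y ω).stronglyMeasurable hind
  have h2 := condExp_add (hX.sub hY) hY m
  have h3 := condExp_of_stronglyMeasurable hm hYs hY
  have h4 : X = (X - Y) + Y := (sub_add_cancel X Y).symm
  rw [h4]
  filter_upwards [h1, h2] with ω h1 h2
  rw [h2, Pi.add_apply, h3]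
  have : (μ[X - Y | m]) ω = 0 := h1.trans h0
  rw [this, zero_add]

end Independence

/-! ### The Kalman filter: laws and independence of errors and innovations -/

namespace LinearSystem

variable {Ω : Type*} [MeasurableSpace Ω] {μ : Measure Ω} [IsProbabilityMeasure μ] {n m : ℕ}
  {S : LinearSystem Ω n m}

theorem IsGaussian.measurable_x (hS : S.IsGaussian μ) (k : ℕ) : Measurable (S.x k) := by
  induction k with
  | zero => exact hS.measurable_x₀
  | succ k ih => exact ((continuous_toLpLin S.A).measurable.comp ih).add (hS.measurable_w k)

theorem IsGaussian.measurable_y (hS : S.IsGaussian μ) (k : ℕ) : Measurable (S.y k) :=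
  ((continuous_toLpLin S.C).measurable.comp (hS.measurable_x k)).add (hS.measurable_v k)

theorem IsGaussian.obs_le (hS : S.IsGaussian μ) (k : ℕ) : S.obs k ≤ ‹MeasurableSpace Ω› :=
  iSup_le fun j => (hS.measurable_y j).comap_le

theorem obs_mono : Monotone S.obs := fun _ j hij =>
  iSup_le fun l => le_iSup (fun l : Fin j => sigmaOf (S.y l)) ⟨l, l.2.trans_le hij⟩

theorem measurable_y_obs {j k : ℕ} (h : j < k) : Measurable[S.obs k] (S.y j) :=
  measurable_iff_comap_le.2 (le_iSup (fun l : Fin k => sigmaOf (S.y l)) ⟨j, h⟩)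

theorem obs_succ (k : ℕ) : S.obs (k + 1) = S.obs k ⊔ sigmaOf (S.y k) := by
  refine le_antisymm (iSup_le fun j => ?_) (sup_le (obs_mono k.le_succ) ?_)
  · rcases Nat.lt_succ_iff_lt_or_eq.1 j.2 with h | h
    · exact (measurable_iff_comap_le.1 (measurable_y_obs h)).trans le_sup_left
    · rw [h]
      exact le_sup_right
  · exact measurable_iff_comap_le.1 (measurable_y_obs k.lt_succ_self)

/-- The σ-algebra generated by the initial state and the noises before time `k`. -/
@[reducible] def past (S : LinearSystem Ω n m) (k : ℕ) : MeasurableSpace Ω :=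
  ((⨆ j ∈ Set.Iio k, sigmaOf (S.w j)) ⊔ sigmaOf S.x₀) ⊔ ⨆ j ∈ Set.Iio k, sigmaOf (S.v j)

theorem past_mono : Monotone S.past := fun _ _ hij =>
  sup_le_sup (sup_le_sup (biSup_mono fun _ h => lt_of_lt_of_le h hij) le_rfl)
    (biSup_mono fun _ h => lt_of_lt_of_le h hij)

theorem measurable_w_past {j k : ℕ} (h : j < k) : Measurable[S.past k] (S.w j) :=
  measurable_iff_comap_le.2
    (((le_biSup (fun j => sigmaOf (S.w j)) (Set.mem_Iio.2 h)).trans le_sup_left).trans le_sup_left)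

theorem measurable_v_past {j k : ℕ} (h : j < k) : Measurable[S.past k] (S.v j) :=
  measurable_iff_comap_le.2
    ((le_biSup (fun j => sigmaOf (S.v j)) (Set.mem_Iio.2 h)).trans le_sup_right)

theorem measurable_x_past (k : ℕ) : Measurable[S.past k] (S.x k) := by
  induction k with
  | zero => exact measurable_iff_comap_le.2 (le_sup_right.trans le_sup_left)
  | succ k ih =>
    exact ((continuous_toLpLin S.A).measurable.comp (ih.mono (past_mono k.le_succ) le_rfl)).add
      (measurable_w_past k.lt_succ_self)

theorem obs_le_past (k : ℕ) : S.obs k ≤ S.past k := by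
  refine iSup_le fun j => measurable_iff_comap_le.1 ?_
  exact ((continuous_toLpLin S.C).measurable.comp
    ((measurable_x_past j).mono (past_mono j.2.le) le_rfl)).add (measurable_v_past j.2)

theorem indep_white_iSup {F : Type*} [MeasurableSpace F] {u : ℕ → Ω → F}
    (hu : ∀ k, Measurable (u k)) (h : iIndepFun u μ) (k : ℕ) :
    Indep (sigmaOf (u k)) (⨆ j ∈ Set.Iio k, sigmaOf (u j)) μ := by
  have := indep_iSup_of_disjoint (fun j => (hu j).comap_le) h.iIndep
    (S := {k}) (T := Set.Iio k) (by simp)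
  simpa using this

theorem sup_iSup_le_sigmaOf {F : Type*} [MeasurableSpace F] (u : ℕ → Ω → F) (k : ℕ) :
    sigmaOf (u k) ⊔ ⨆ j ∈ Set.Iio k, sigmaOf (u j) ≤ sigmaOf fun ω j => u j ω := by
  have h : ∀ j, sigmaOf (u j) ≤ sigmaOf fun ω j => u j ω := fun j =>
    measurable_iff_comap_le.1 ((measurable_pi_apply j).comp (measurable_sigmaOf fun ω j => u j ω))
  exact sup_le (h k) (iSup₂_le fun j _ => h j)

theorem IsGaussian.indep_v_past (hS : S.IsGaussian μ) (k : ℕ) :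
    Indep (sigmaOf (S.v k)) (S.past k) μ := by
  have hwm : Measurable fun ω k => S.w k ω := measurable_pi_iff.2 hS.measurable_w
  have hvm : Measurable fun ω k => S.v k ω := measurable_pi_iff.2 hS.measurable_v
  have hsup : (⨆ j ∈ Set.Iio k, sigmaOf (S.v j)) ≤ ‹MeasurableSpace Ω› :=
    iSup₂_le fun j _ => (hS.measurable_v j).comap_le
  have h1 := indep_sup_of_indep_sup (hS.measurable_v k).comap_le hsup hwm.comap_le
    (indep_white_iSup hS.measurable_v hS.white_v k)
    (indep_of_indep_of_le_left hS.indep_w_v.symm (sup_iSup_le_sigmaOf S.v k))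
  have hle : sigmaOf (S.v k) ⊔ ((⨆ j ∈ Set.Iio k, sigmaOf (S.v j)) ⊔ sigmaOf fun ω k => S.w k ω) ≤
      sigmaOf fun ω => (fun k => S.w k ω, fun k => S.v k ω) := by
    rw [← sup_assoc]
    refine sup_le ((sup_iSup_le_sigmaOf S.v k).trans ?_) ?_
    · exact measurable_iff_comap_le.1 (measurable_snd.comp (measurable_sigmaOf _))
    · exact measurable_iff_comap_le.1 (measurable_fst.comp (measurable_sigmaOf _))
  have h2 := indep_sup_of_indep_sup (hS.measurable_v k).comap_le (sup_le hsup hwm.comap_le)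
    hS.measurable_x₀.comap_le h1 (indep_of_indep_of_le_left hS.indep_x₀.symm hle)
  refine indep_of_indep_of_le_right h2 (sup_le (sup_le ?_ le_sup_right) ?_)
  · exact ((le_sup_right.trans (sup_iSup_le_sigmaOf S.w k)).trans le_sup_right).trans le_sup_left
  · exact le_sup_left.trans le_sup_left

theorem IsGaussian.indep_w_past (hS : S.IsGaussian μ) (k : ℕ) :
    Indep (sigmaOf (S.w k)) (S.past k ⊔ sigmaOf (S.v k)) μ := by
  have hwm : Measurable fun ω k => S.w k ω := measurable_pi_iff.2 hS.measurable_w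
  have hvm : Measurable fun ω k => S.v k ω := measurable_pi_iff.2 hS.measurable_v
  have hsup : (⨆ j ∈ Set.Iio k, sigmaOf (S.w j)) ≤ ‹MeasurableSpace Ω› :=
    iSup₂_le fun j _ => (hS.measurable_w j).comap_le
  have h1 := indep_sup_of_indep_sup (hS.measurable_w k).comap_le hsup hvm.comap_le
    (indep_white_iSup hS.measurable_w hS.white_w k)
    (indep_of_indep_of_le_left hS.indep_w_v (sup_iSup_le_sigmaOf S.w k))
  have hle : sigmaOf (S.w k) ⊔ ((⨆ j ∈ Set.Iio k, sigmaOf (S.w j)) ⊔ sigmaOf fun ω k => S.v k ω) ≤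
      sigmaOf fun ω => (fun k => S.w k ω, fun k => S.v k ω) := by
    rw [← sup_assoc]
    refine sup_le ((sup_iSup_le_sigmaOf S.w k).trans ?_) ?_
    · exact measurable_iff_comap_le.1 (measurable_fst.comp (measurable_sigmaOf _))
    · exact measurable_iff_comap_le.1 (measurable_snd.comp (measurable_sigmaOf _))
  have h2 := indep_sup_of_indep_sup (hS.measurable_w k).comap_le (sup_le hsup hvm.comap_le)
    hS.measurable_x₀.comap_le h1 (indep_of_indep_of_le_left hS.indep_x₀.symm hle)
  have hv : sigmaOf (S.v k) ⊔ ⨆ j ∈ Set.Iio k, sigmaOf (S.v j) ≤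
      ((⨆ j ∈ Set.Iio k, sigmaOf (S.w j)) ⊔ sigmaOf fun ω k => S.v k ω) ⊔ sigmaOf S.x₀ :=
    ((sup_iSup_le_sigmaOf S.v k).trans le_sup_right).trans le_sup_left
  exact indep_of_indep_of_le_right h2 (sup_le (sup_le (sup_le (le_sup_left.trans le_sup_left)
    le_sup_right) (le_sup_right.trans hv)) (le_sup_left.trans hv))

theorem measurable_xPred (k : ℕ) : Measurable[S.obs k] (S.xPred μ k) :=
  stronglyMeasurable_condExp.measurable

theorem measurable_xLoc (k : ℕ) : Measurable[S.obs (k + 1)] (S.xLoc μ k) :=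
  stronglyMeasurable_condExp.measurable

theorem measurable_z (k : ℕ) : Measurable[S.obs (k + 1)] (S.z μ k) :=
  (measurable_xLoc k).sub ((measurable_xPred k).mono (obs_mono k.le_succ) le_rfl)

/-- The one-step prediction error is a centered nondegenerate Gaussian vector, independent of the
measurements. -/
structure HasPredictionError (S : LinearSystem Ω n m) (μ : Measure Ω) (k : ℕ)
    (P : Matrix (Fin n) (Fin n) ℝ) : Prop where
  posDef : P.PosDef
  memLp_x : MemLp (S.x k) 2 μ
  law : HasLaw (fun ω => S.x k ω - S.xPred μ k ω) (multivariateGaussian 0 P) μ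
  indep : Indep (sigmaOf fun ω => S.x k ω - S.xPred μ k ω) (S.obs k) μ

/-- The estimation error is a centered Gaussian vector, independent of the measurements, and the
estimate innovation is Gaussian and independent of the past measurements. -/
structure HasEstimationError (S : LinearSystem Ω n m) (μ : Measure Ω) (k : ℕ)
    (P Sig : Matrix (Fin n) (Fin n) ℝ) : Prop where
  posSemidef : P.PosSemidef
  posSemidef_innovation : Sig.PosSemidef
  rank_innovation : Sig.rank = S.C.rank
  law : HasLaw (fun ω => S.x k ω - S.xLoc μ k ω) (multivariateGaussian 0 P) μ
  indep : Indep (sigmaOf fun ω => S.x k ω - S.xLoc μ k ω) (S.obs (k + 1)) μ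
  law_z : HasLaw (S.z μ k) (multivariateGaussian 0 Sig) μ
  indep_z : Indep (sigmaOf (S.z μ k)) (S.obs k) μ

/-- Measurement update. With the Kalman gain `K`, the residual `e'` is independent of the output
innovation `y` and of the past measurements, hence of `S.obs (k + 1)`. Therefore the local estimate
is the prediction plus `K y`, and `z_k = K y` almost surely. -/
theorem HasPredictionError.hasEstimationError (hS : S.IsGaussian μ) {k : ℕ}
    {P : Matrix (Fin n) (Fin n) ℝ} (h : S.HasPredictionError μ k P) :
    ∃ P' Sig, S.HasEstimationError μ k P' Sig ∧ P = P' + Sig := by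
  set e : Ω → EuclideanSpace ℝ (Fin n) := fun ω => S.x k ω - S.xPred μ k ω with he
  have hPm : Measurable (S.xPred μ k) := (measurable_xPred k).mono (hS.obs_le k) le_rfl
  have hem : Measurable e := (hS.measurable_x k).sub hPm
  have hCm := (continuous_toLpLin S.C).measurable
  have hepast : sigmaOf e ≤ S.past k := measurable_iff_comap_le.1
    ((measurable_x_past k).sub ((measurable_xPred k).mono (obs_le_past k) le_rfl))
  have hve := hS.indep_v_past k
  have hev : IndepFun e (S.v k) μ := (indep_of_indep_of_le_right hve hepast).symm
  set T := S.C * P * S.Cᵀ + S.R with hT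
  have hTpos : T.PosDef :=
    (hS.posDef_R.posSemidef_add (h.posDef.posSemidef.mul_mul_conjTranspose_same S.C))
  have hTdet : IsUnit T.det := (Matrix.isUnit_iff_isUnit_det _).1 hTpos.isUnit
  set K := P * S.Cᵀ * T⁻¹ with hK
  have hKT : K * T = P * S.Cᵀ := by
    rw [hK, Matrix.mul_assoc, Matrix.nonsing_inv_mul _ hTdet, Matrix.mul_one]
  set y : Ω → EuclideanSpace ℝ (Fin m) := fun ω => Matrix.toLpLin 2 2 S.C (e ω) + S.v k ω with hy
  have hym : Measurable y := (hCm.comp hem).add (hS.measurable_v k)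
  have hKm := (continuous_toLpLin K).measurable
  set e' : Ω → EuclideanSpace ℝ (Fin n) := fun ω => e ω - Matrix.toLpLin 2 2 K (y ω) with he'
  have hem' : Measurable e' := hem.sub (hKm.comp hym)
  have hind : IndepFun e' y μ := indepFun_error_innovation h.posDef.posSemidef
    hS.posDef_R.posSemidef h.law (hS.law_v k) hev S.C K hKT
  have hobs : Indep (sigmaOf e ⊔ sigmaOf (S.v k)) (S.obs k) μ := by
    refine (indep_sup_of_indep_sup (hS.obs_le k) hem.comap_le (hS.measurable_v k).comap_le
      h.indep.symm ?_).symm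
    exact indep_of_indep_of_le_left hve.symm (sup_le (obs_le_past k) hepast)
  have hemv : Measurable[sigmaOf e ⊔ sigmaOf (S.v k)] e :=
    (measurable_sigmaOf e).mono le_sup_left le_rfl
  have hymv : Measurable[sigmaOf e ⊔ sigmaOf (S.v k)] y :=
    (hCm.comp hemv).add ((measurable_sigmaOf (S.v k)).mono le_sup_right le_rfl)
  have hemv' : Measurable[sigmaOf e ⊔ sigmaOf (S.v k)] e' := hemv.sub (hKm.comp hymv)
  have hyobs : Indep (sigmaOf y) (S.obs k) μ :=
    indep_of_indep_of_le_left hobs (measurable_iff_comap_le.1 hymv)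
  have hyeq : ∀ ω, S.y k ω = Matrix.toLpLin 2 2 S.C (S.xPred μ k ω) + y ω := fun ω => by
    simp only [LinearSystem.y, hy, he, map_sub]
    abel
  have hobs_succ : S.obs (k + 1) ≤ sigmaOf y ⊔ S.obs k := by
    rw [obs_succ]
    refine sup_le le_sup_right (measurable_iff_comap_le.1 ?_)
    rw [funext hyeq]
    exact (hCm.comp ((measurable_xPred k).mono le_sup_right le_rfl)).add
      ((measurable_sigmaOf y).mono le_sup_left le_rfl)
  have hind' : Indep (sigmaOf e') (S.obs (k + 1)) μ := by
    refine indep_of_indep_of_le_right (indep_sup_of_indep_sup hem'.comap_le hym.comap_le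
      (hS.obs_le k) hind ?_) hobs_succ
    exact indep_of_indep_of_le_left hobs (sup_le (measurable_iff_comap_le.1 hemv')
      (measurable_iff_comap_le.1 hymv))
  have hyobs' : Measurable[S.obs (k + 1)] y := by
    have : y = fun ω => S.y k ω - Matrix.toLpLin 2 2 S.C (S.xPred μ k ω) := by
      ext1 ω
      rw [hyeq, add_sub_cancel_left]
    rw [this]
    exact (measurable_y_obs k.lt_succ_self).sub
      (hCm.comp ((measurable_xPred k).mono (obs_mono k.le_succ) le_rfl))
  have hRps := hS.posDef_R.posSemidef
  have hPps := h.posDef.posSemidef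
  have hylaw : HasLaw y (multivariateGaussian 0 T) μ :=
    hasLaw_add_multivariateGaussian (hasLaw_toLpLin_multivariateGaussian h.law hPps S.C)
      (hS.law_v k) (hPps.mul_mul_conjTranspose_same S.C) hRps
      (hev.comp hCm measurable_id)
  set Sig := K * T * Kᵀ with hSig
  have hSigps : Sig.PosSemidef := hTpos.posSemidef.mul_mul_conjTranspose_same K
  have hKylaw : HasLaw (fun ω => Matrix.toLpLin 2 2 K (y ω)) (multivariateGaussian 0 Sig) μ :=
    hasLaw_toLpLin_multivariateGaussian hylaw hTpos.posSemidef K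
  set J := 1 - K * S.C with hJ
  -- Joseph form of the posterior covariance, read off from `e' = J e - K v`; it is visibly positive
  -- semidefinite.
  set P' := J * P * Jᵀ + (-K) * S.R * (-K)ᵀ with hP'
  have hJps : (J * P * Jᵀ).PosSemidef := hPps.mul_mul_conjTranspose_same J
  have hKps : ((-K) * S.R * (-K)ᵀ).PosSemidef := hRps.mul_mul_conjTranspose_same (-K)
  have hP'ps : P'.PosSemidef := hJps.add hKps
  have helaw' : HasLaw e' (multivariateGaussian 0 P') μ := by
    have h1 := hasLaw_add_multivariateGaussian (hasLaw_toLpLin_multivariateGaussian h.law hPps J)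
      (hasLaw_toLpLin_multivariateGaussian (hS.law_v k) hRps (-K)) hJps hKps
      (hev.comp (continuous_toLpLin J).measurable (continuous_toLpLin (-K)).measurable)
    have h2 : e' = fun ω => Matrix.toLpLin 2 2 J (e ω) + Matrix.toLpLin 2 2 (-K) (S.v k ω) := by
      ext1 ω
      simp only [he', hy, hJ, map_sub, map_neg, map_add, Matrix.toLpLin_one,
        Matrix.toLpLin_mul_same, LinearMap.sub_apply, LinearMap.id_apply, LinearMap.neg_apply,
        LinearMap.comp_apply]
      abel
    rw [h2]
    exact h1
  have hxLoc : S.xLoc μ k =ᵐ[μ] fun ω => S.xPred μ k ω + Matrix.toLpLin 2 2 K (y ω) := by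
    have hsub : (fun ω => S.x k ω - (S.xPred μ k ω + Matrix.toLpLin 2 2 K (y ω))) = e' := by
      ext1 ω
      simp only [he', he]
      abel
    refine condExp_eq_of_indep_sub (hS.obs_le (k + 1)) (h.memLp_x.integrable (by norm_num)) ?_
      (hS.measurable_x k) ?_ ?_ ?_
    · exact integrable_condExp.add
        ((memLp_two_of_hasLaw_multivariateGaussian hKylaw).integrable (by norm_num))
    · exact ((measurable_xPred k).mono (obs_mono k.le_succ) le_rfl).add (hKm.comp hyobs')
    · rw [hsub]
      exact hind'
    · rw [hsub]
      exact integral_of_hasLaw_multivariateGaussian helaw'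
  have he'eq : (fun ω => S.x k ω - S.xLoc μ k ω) =ᵐ[μ] e' := by
    filter_upwards [hxLoc] with ω hω
    simp only [he', he, hω]
    abel
  have hzeq : S.z μ k =ᵐ[μ] fun ω => Matrix.toLpLin 2 2 K (y ω) := by
    filter_upwards [hxLoc] with ω hω
    simp only [LinearSystem.z, hω, add_sub_cancel_left]
  refine ⟨P', Sig, ⟨hP'ps, hSigps, ?_, helaw'.congr he'eq, indep_sigmaOf_congr he'eq.symm hind',
    hKylaw.congr hzeq, indep_sigmaOf_congr hzeq.symm ?_⟩, ?_⟩
  -- The innovation covariance is `(C P)ᵀ T⁻¹ (C P)` with `T` and `P` invertible, so its rank is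
  -- that of `C`.
  · have hPdet : IsUnit P.det := (Matrix.isUnit_iff_isUnit_det _).1 h.posDef.isUnit
    have hPt : Pᵀ = P := h.posDef.isHermitian
    have : Sig = (S.C * P)ᵀ * T⁻¹ * (S.C * P) := by
      have hTt : (T⁻¹)ᵀ = T⁻¹ := hTpos.inv.isHermitian
      rw [hSig, hKT, hK, Matrix.transpose_mul, Matrix.transpose_mul, Matrix.transpose_mul,
        Matrix.transpose_transpose, hPt, hTt]
      simp only [Matrix.mul_assoc]
    rw [this, hTpos.inv.rank_transpose_mul_mul, Matrix.rank_mul_eq_left_of_isUnit_det _ _ hPdet]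
  · exact indep_of_indep_of_le_left hyobs (measurable_iff_comap_le.1
      (hKm.comp (measurable_sigmaOf y)))
  -- The Riccati identity comes from comparing second moments in `e = e' + K y`, a sum of
  -- independent terms, rather than from matrix algebra.
  · have hsum := hasLaw_add_multivariateGaussian helaw' hKylaw hP'ps hSigps
      (hind.comp measurable_id hKm)
    have : (fun ω => e' ω + Matrix.toLpLin 2 2 K (y ω)) = e := by
      ext1 ω
      simp only [he', sub_add_cancel]
    rw [this] at hsum
    ext i j
    rw [← integral_mul_of_hasLaw_multivariateGaussian h.law hPps,
      ← integral_mul_of_hasLaw_multivariateGaussian hsum (hP'ps.add hSigps)]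

/-- Time update: the new prediction error is `A e + w_k`, with `w_k` independent of `e` and of the
measurements. Positive definiteness of `Q` keeps the prediction covariance invertible, as the rank
computation requires. -/
theorem HasEstimationError.hasPredictionError_succ (hS : S.IsGaussian μ) {k : ℕ}
    {P Sig : Matrix (Fin n) (Fin n) ℝ} (hx : MemLp (S.x k) 2 μ)
    (h : S.HasEstimationError μ k P Sig) :
    S.HasPredictionError μ (k + 1) (S.A * P * S.Aᵀ + S.Q) ∧
      S.xPred μ (k + 1) =ᵐ[μ] fun ω => Matrix.toLpLin 2 2 S.A (S.xLoc μ k ω) := by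
  have hAm := (continuous_toLpLin S.A).measurable
  have hLm : Measurable (S.xLoc μ k) := (measurable_xLoc k).mono (hS.obs_le _) le_rfl
  set e : Ω → EuclideanSpace ℝ (Fin n) := fun ω => S.x k ω - S.xLoc μ k ω with he
  have hem : Measurable e := (hS.measurable_x k).sub hLm
  have hobs_past : S.obs (k + 1) ≤ S.past k ⊔ sigmaOf (S.v k) := by
    rw [obs_succ]
    refine sup_le ((obs_le_past k).trans le_sup_left) (measurable_iff_comap_le.1 ?_)
    exact ((continuous_toLpLin S.C).measurable.comp
      ((measurable_x_past k).mono le_sup_left le_rfl)).add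
      ((measurable_sigmaOf (S.v k)).mono le_sup_right le_rfl)
  have hepast : sigmaOf e ≤ S.past k ⊔ sigmaOf (S.v k) := measurable_iff_comap_le.1
    (((measurable_x_past k).mono le_sup_left le_rfl).sub ((measurable_xLoc k).mono hobs_past le_rfl))
  have hwe := hS.indep_w_past k
  have hew : IndepFun e (S.w k) μ := (indep_of_indep_of_le_right hwe hepast).symm
  have hobs : Indep (sigmaOf e ⊔ sigmaOf (S.w k)) (S.obs (k + 1)) μ :=
    (indep_sup_of_indep_sup (hS.obs_le _) hem.comap_le (hS.measurable_w k).comap_le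
      h.indep.symm (indep_of_indep_of_le_left hwe.symm (sup_le hobs_past hepast))).symm
  set e' : Ω → EuclideanSpace ℝ (Fin n) := fun ω => Matrix.toLpLin 2 2 S.A (e ω) + S.w k ω with he'
  have hwm : Measurable[sigmaOf e ⊔ sigmaOf (S.w k)] (S.w k) :=
    (measurable_sigmaOf (S.w k)).mono le_sup_right le_rfl
  have hesup : Measurable[sigmaOf e ⊔ sigmaOf (S.w k)] e :=
    (measurable_sigmaOf e).mono le_sup_left le_rfl
  have hem'' : Measurable[sigmaOf e ⊔ sigmaOf (S.w k)] e' :=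
    (hAm.comp hesup).add hwm
  have hind' : Indep (sigmaOf e') (S.obs (k + 1)) μ :=
    indep_of_indep_of_le_left hobs (measurable_iff_comap_le.1 hem'')
  have hAps : (S.A * P * S.Aᵀ).PosSemidef := h.posSemidef.mul_mul_conjTranspose_same S.A
  have hlaw' : HasLaw e' (multivariateGaussian 0 (S.A * P * S.Aᵀ + S.Q)) μ :=
    hasLaw_add_multivariateGaussian (hasLaw_toLpLin_multivariateGaussian h.law h.posSemidef S.A)
      (hS.law_w k) hAps hS.posDef_Q.posSemidef (hew.comp hAm measurable_id)
  have hx' : MemLp (S.x (k + 1)) 2 μ :=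
    ((LinearMap.toContinuousLinearMap (Matrix.toLpLin 2 2 S.A)).comp_memLp' hx).add
      (memLp_two_of_hasLaw_multivariateGaussian (hS.law_w k))
  have hsub : (fun ω => S.x (k + 1) ω - Matrix.toLpLin 2 2 S.A (S.xLoc μ k ω)) = e' := by
    ext1 ω
    simp only [LinearSystem.x, he', he, map_sub]
    abel
  have hpred : S.xPred μ (k + 1) =ᵐ[μ] fun ω => Matrix.toLpLin 2 2 S.A (S.xLoc μ k ω) := by
    refine condExp_eq_of_indep_sub (hS.obs_le (k + 1)) (hx'.integrable (by norm_num)) ?_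
      (hS.measurable_x (k + 1)) (hAm.comp (measurable_xLoc k)) ?_ ?_
    · exact (LinearMap.toContinuousLinearMap (Matrix.toLpLin 2 2 S.A)).integrable_comp
        integrable_condExp
    · rw [hsub]
      exact hind'
    · rw [hsub]
      exact integral_of_hasLaw_multivariateGaussian hlaw'
  have he'eq : (fun ω => S.x (k + 1) ω - S.xPred μ (k + 1) ω) =ᵐ[μ] e' := by
    filter_upwards [hpred] with ω hω
    rw [hω]
    exact congrFun hsub ω
  exact ⟨⟨hS.posDef_Q.posSemidef_add hAps, hx', hlaw'.congr he'eq,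
    indep_sigmaOf_congr he'eq.symm hind'⟩, hpred⟩

theorem IsGaussian.exists_hasPredictionError (hS : S.IsGaussian μ) (k : ℕ) :
    ∃ P, S.HasPredictionError μ k P := by
  induction k with
  | zero =>
    have hx : MemLp (S.x 0) 2 μ := memLp_two_of_hasLaw_multivariateGaussian hS.law_x₀
    have hbot : S.obs 0 = ⊥ := iSup_of_empty _
    have hpred : S.xPred μ 0 = fun _ => S.mean₀ := by
      rw [LinearSystem.xPred, hbot, condExp_bot]
      ext1 _
      exact integral_of_hasLaw_multivariateGaussian hS.law_x₀
    refine ⟨S.P₀, hS.posDef_P₀, hx, ?_, ?_⟩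
    · rw [hpred]
      refine HasLaw.fun_comp (Y := fun x => x - S.mean₀) ⟨by fun_prop, ?_⟩ hS.law_x₀
      rw [multivariateGaussian, multivariateGaussian, Measure.map_map (by fun_prop) (by fun_prop)]
      congr 1
      ext1 x
      simp
    · rw [hbot]
      exact indep_bot_right _
  | succ k ih =>
    obtain ⟨P, hP⟩ := ih
    obtain ⟨P', Sig, h, -⟩ := hP.hasEstimationError hS
    exact ⟨_, (h.hasPredictionError_succ hS hP.memLp_x).1⟩

theorem IsGaussian.memLp_x (hS : S.IsGaussian μ) (k : ℕ) : MemLp (S.x k) 2 μ :=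
  (hS.exists_hasPredictionError k).choose_spec.memLp_x

theorem IsGaussian.hasEstimationError (hS : S.IsGaussian μ) (k : ℕ) :
    S.HasEstimationError μ k (S.PLoc μ k) (S.PPred μ k - S.PLoc μ k) := by
  obtain ⟨P, hP⟩ := hS.exists_hasPredictionError k
  obtain ⟨P', Sig, h, hsum⟩ := hP.hasEstimationError hS
  have h1 : S.PLoc μ k = P' := by
    ext i j
    exact integral_mul_of_hasLaw_multivariateGaussian h.law h.posSemidef i j
  have h2 : S.PPred μ k = P := by
    ext i j
    exact integral_mul_of_hasLaw_multivariateGaussian hP.law hP.posDef.posSemidef i j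
  rw [h1, h2, hsum, add_sub_cancel_left]
  exact h

theorem IsGaussian.xPred_succ (hS : S.IsGaussian μ) (k : ℕ) :
    S.xPred μ (k + 1) =ᵐ[μ] fun ω => Matrix.toLpLin 2 2 S.A (S.xLoc μ k ω) :=
  ((hS.hasEstimationError k).hasPredictionError_succ hS (hS.memLp_x k)).2

/-! ### Normalized innovations are standard Gaussian and determine the innovations -/

section Innovation

variable {U : ℕ → Matrix (Fin n) (Fin n) ℝ} {D : ℕ → Fin n → ℝ}

theorem measurable_innov (k : ℕ) : Measurable[S.obs (k + 1)] (S.innov μ U D k) :=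
  (continuous_toLpLin _).measurable.comp (measurable_z k)

theorem IsGaussian.indep_innov (hS : S.IsGaussian μ) (k : ℕ) :
    Indep (sigmaOf (S.innov μ U D k)) (S.obs k) μ :=
  indep_of_indep_of_le_left (hS.hasEstimationError k).indep_z (measurable_iff_comap_le.1
    ((continuous_toLpLin _).measurable.comp (measurable_sigmaOf (S.z μ k))))

theorem IsGaussian.hasLaw_innov (hS : S.IsGaussian μ)
    (hUD : ∀ k, IsOrderedEigendecomposition (S.PPred μ k - S.PLoc μ k) (U k) (D k)) (k : ℕ) :
    HasLaw (S.innov μ U D k) (stdGaussian (EuclideanSpace ℝ (Fin S.q))) μ := by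
  have h := hS.hasEstimationError k
  have h1 := hasLaw_toLpLin_multivariateGaussian h.law_z h.posSemidef_innovation
    (normalizer S.q (U k) (D k))
  rw [normalizer_mul_mul_transpose (q := S.q) (hUD k) h.posSemidef_innovation h.rank_innovation,
    multivariateGaussian_zero_one] at h1
  exact h1

/-- The matrix recovering the innovation `z_k` from the normalized innovation. -/
def innovGain (S : LinearSystem Ω n m) (μ : Measure Ω) (U : ℕ → Matrix (Fin n) (Fin n) ℝ)
    (D : ℕ → Fin n → ℝ) (k : ℕ) : Matrix (Fin n) (Fin S.q) ℝ :=
  (S.PPred μ k - S.PLoc μ k) * (normalizer S.q (U k) (D k))ᵀ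

theorem IsGaussian.innovGain_mul_transpose (hS : S.IsGaussian μ)
    (hUD : ∀ k, IsOrderedEigendecomposition (S.PPred μ k - S.PLoc μ k) (U k) (D k)) (k : ℕ) :
    S.innovGain μ U D k * (S.innovGain μ U D k)ᵀ = S.PPred μ k - S.PLoc μ k := by
  have h := hS.hasEstimationError k
  have ht : (S.PPred μ k - S.PLoc μ k)ᵀ = S.PPred μ k - S.PLoc μ k :=
    h.posSemidef_innovation.isHermitian
  rw [innovGain, Matrix.transpose_mul, ht, Matrix.transpose_transpose, ← Matrix.mul_assoc]
  exact mul_normalizer_transpose_mul_mul (hUD k) h.posSemidef_innovation h.rank_innovation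

/-- The difference of the two sides is a centered Gaussian vector with covariance 0, by the
generalized inverse identity. -/
theorem IsGaussian.z_eq_innov (hS : S.IsGaussian μ)
    (hUD : ∀ k, IsOrderedEigendecomposition (S.PPred μ k - S.PLoc μ k) (U k) (D k)) (k : ℕ) :
    S.z μ k =ᵐ[μ] fun ω => Matrix.toLpLin 2 2 (S.innovGain μ U D k) (S.innov μ U D k ω) := by
  have h := hS.hasEstimationError k
  set F := normalizer S.q (U k) (D k) with hF
  set G := S.innovGain μ U D k with hG
  have h1 := hasLaw_toLpLin_multivariateGaussian h.law_z h.posSemidef_innovation (1 - G * F)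
  have h2 : (1 - G * F) * (S.PPred μ k - S.PLoc μ k) = 0 := by
    have := mul_normalizer_transpose_mul_mul (hUD k) h.posSemidef_innovation h.rank_innovation
    rw [Matrix.sub_mul, Matrix.one_mul, sub_eq_zero, hG, innovGain, ← hF]
    exact this.symm
  rw [h2, Matrix.zero_mul] at h1
  filter_upwards [ae_eq_zero_of_hasLaw_multivariateGaussian_zero h1] with ω hω
  rw [map_sub, Matrix.toLpLin_one, Matrix.toLpLin_mul (q := 2)] at hω
  exact sub_eq_zero.1 hω

end Innovation

end LinearSystem

/-! ### Deterministic analysis of the triggering rule -/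

section Decisions

theorem lastTransmission_eq_of_forall {k t : ℕ} {h : Fin k → Bool} (ht : t < k)
    (h1 : h ⟨t, ht⟩ = true) (h2 : ∀ j : Fin k, t < j → h j = false) : lastTransmission h = t := by
  refine le_antisymm (Finset.sup_le fun j hj => ?_) ?_
  · by_contra hlt
    simp [h2 j (not_le.1 hlt)] at hj
  · exact Finset.le_sup (f := fun j : Fin k => (j : ℕ)) (b := ⟨t, ht⟩) (by simp [h1])

theorem lastTransmission_spec {k : ℕ} {h : Fin k → Bool} (hk : 0 < k) (h0 : h ⟨0, hk⟩ = true) :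
    ∃ ht : lastTransmission h < k, h ⟨lastTransmission h, ht⟩ = true ∧
      ∀ j : Fin k, lastTransmission h < j → h j = false := by
  have hne : (Finset.univ.filter fun j => h j = true).Nonempty := ⟨⟨0, hk⟩, by simp [h0]⟩
  obtain ⟨j, hj, hsup⟩ := Finset.exists_mem_eq_sup _ hne fun j : Fin k => (j : ℕ)
  have hlast : lastTransmission h = j := hsup
  refine ⟨hlast ▸ j.2, ?_, fun i hi => ?_⟩
  · simp only [hlast]
    simpa using hj
  · by_contra hne
    have : (i : ℕ) ≤ lastTransmission h :=
      Finset.le_sup (f := fun j : Fin k => (j : ℕ)) (by simpa using hne)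
    omega

theorem decision_zero (thr : (k : ℕ) → (Fin k → Bool) → ℝ) (e : ℕ → ℝ) :
    decision thr e 0 = true := by
  rw [decision]

theorem decision_of_pos (thr : (k : ℕ) → (Fin k → Bool) → ℝ) (e : ℕ → ℝ) {k : ℕ} (hk : 0 < k) :
    decision thr e k = decide (thr k (fun j => decision thr e j) <
      ∑ i ∈ Finset.Ioc (lastTransmission fun j : Fin k => decision thr e j) k, e i) := by
  obtain ⟨k, rfl⟩ := Nat.exists_eq_succ_of_ne_zero hk.ne'
  rw [decision]

theorem sum_Ioc_add_eq {t τ : ℕ} (f : ℕ → ℝ) (s : Fin τ) :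
    ∑ i ∈ Finset.Ioc t (t + 1 + s), f i = ∑ r : Fin τ with r ≤ s, f (t + 1 + (r : ℕ)) := by
  symm
  refine Finset.sum_bij (fun (r : Fin τ) _ => t + 1 + (r : ℕ)) (fun r hr => ?_) (fun a _ b _ h => ?_)
    (fun i hi => ?_) fun _ _ => rfl
  · have : (r : ℕ) ≤ s := (Finset.mem_filter.1 hr).2
    rw [Finset.mem_Ioc]
    omega
  · exact Fin.ext (by omega)
  · rw [Finset.mem_Ioc] at hi
    exact ⟨⟨i - (t + 1), by omega⟩, Finset.mem_filter.2 ⟨Finset.mem_univ _, Fin.le_def.2 (by simp only; omega)⟩,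
      by simp only; omega⟩

/-- The values of the normalized innovations after a transmission at time `t` for which no
transmission follows during the next `τ` steps, along the decision history `g`. -/
def silentSet (thr : (k : ℕ) → (Fin k → Bool) → ℝ) (g : ℕ → Bool) (t τ q : ℕ) :
    Set (PiLp 2 fun _ : Fin τ => EuclideanSpace ℝ (Fin q)) :=
  {x | ∀ s : Fin τ, ∑ r : Fin τ with r ≤ s, ‖x r‖ ^ 2 ≤ thr (t + 1 + s) fun j => g j}

theorem measurableSet_silentSet (thr : (k : ℕ) → (Fin k → Bool) → ℝ) (g : ℕ → Bool) (t τ q : ℕ) :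
    MeasurableSet (silentSet thr g t τ q) := by
  have : silentSet thr g t τ q = ⋂ s : Fin τ, {x | ∑ r : Fin τ with r ≤ s, ‖x r‖ ^ 2 ≤
      thr (t + 1 + s) fun j => g j} := by
    ext x
    simp [silentSet]
  rw [this]
  exact MeasurableSet.iInter fun s => measurableSet_le (by fun_prop) measurable_const

theorem mem_silentSet_of_norm_le {thr : (k : ℕ) → (Fin k → Bool) → ℝ} {g : ℕ → Bool} {t τ q : ℕ}
    {x : PiLp 2 fun _ : Fin τ => EuclideanSpace ℝ (Fin q)} (hx : x ∈ silentSet thr g t τ q)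
    (y : PiLp 2 fun _ : Fin τ => EuclideanSpace ℝ (Fin q)) (h : ∀ i, ‖y i‖ ≤ ‖x i‖) :
    y ∈ silentSet thr g t τ q := fun s =>
  (Finset.sum_le_sum fun i _ => pow_le_pow_left₀ (norm_nonneg _) (h i) 2).trans (hx s)

theorem norm_sq_le_of_mem_silentSet {thr : (k : ℕ) → (Fin k → Bool) → ℝ} {g : ℕ → Bool}
    {t τ q : ℕ} (hτ : 0 < τ) {x : PiLp 2 fun _ : Fin τ => EuclideanSpace ℝ (Fin q)}
    (hx : x ∈ silentSet thr g t τ q) : ‖x‖ ^ 2 ≤ thr (t + τ) fun j => g j := by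
  -- The constraint at the final time `t + τ` involves all the blocks.
  have h := hx ⟨τ - 1, by omega⟩
  have h1 : (Finset.univ.filter fun r : Fin τ => r ≤ ⟨τ - 1, by omega⟩) = Finset.univ := by
    ext r
    simp only [Finset.mem_filter, Finset.mem_univ, true_and, iff_true, Fin.le_def]
    omega
  have h2 : ∀ a b : ℕ, a = b → thr a (fun j => g j) = thr b fun j => g j := by
    rintro a _ rfl
    rfl
  rw [h1, h2 _ (t + τ) (by simp only; omega)] at h
  rw [PiLp.norm_sq_eq_of_L2]
  exact h

/-- A history with last transmission at time `t` and silence until time `t + τ` is described by the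
decisions up to `t` and by the normalized squared norms afterwards. -/
theorem decision_eq_iff_of_silent {thr : (k : ℕ) → (Fin k → Bool) → ℝ} {e : ℕ → ℝ} {g : ℕ → Bool}
    {t τ : ℕ} (ht : g t = true) (hg : ∀ j, t < j → j ≤ t + τ → g j = false) :
    (∀ j ≤ t + τ, decision thr e j = g j) ↔ (∀ j ≤ t, decision thr e j = g j) ∧
      ∀ s : Fin τ, ∑ r : Fin τ with r ≤ s, e (t + 1 + (r : ℕ)) ≤ thr (t + 1 + s) fun j => g j := by
  have hlast : ∀ s : Fin τ, lastTransmission (fun j : Fin (t + 1 + s) => g j) = t := fun s =>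
    lastTransmission_eq_of_forall (by omega) ht fun j hj => hg j hj (by omega)
  have hdec : ∀ s : Fin τ, (∀ j < t + 1 + s, decision thr e j = g j) →
      decision thr e (t + 1 + s) = decide (thr (t + 1 + s) (fun j => g j) <
        ∑ r : Fin τ with r ≤ s, e (t + 1 + (r : ℕ))) := by
    intro s hs
    have hfun : (fun j : Fin (t + 1 + s) => decision thr e j) =
        fun j : Fin (t + 1 + s) => g j :=
      funext fun j => hs j j.2
    rw [decision_of_pos thr e (by omega), hfun, hlast, sum_Ioc_add_eq]
  constructor
  · intro h
    refine ⟨fun j hj => h j (by omega), fun s => ?_⟩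
    have h1 := hdec s fun j hj => h j (by omega)
    rw [h _ (by omega), hg _ (by omega) (by omega)] at h1
    simpa using h1.symm
  -- Strong induction: once the earlier decisions agree with `g`, the threshold and the last
  -- transmission are those of `g`, and the triggering test is the stated inequality.
  · rintro ⟨h1, h2⟩ j
    induction j using Nat.strong_induction_on with
    | _ j ih =>
      intro hj
      rcases le_or_gt j t with hjt | hjt
      · exact h1 j hjt
      · obtain ⟨s, rfl⟩ : ∃ s : Fin τ, j = t + 1 + s := ⟨⟨j - (t + 1), by omega⟩, by simp only; omega⟩
        rw [hdec s fun i hi => ih i hi (by omega), hg _ hjt hj]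
        simpa using h2 s

end Decisions

/-! ### Information of the remote center along a fixed history -/

namespace LinearSystem

variable {Ω : Type*} [MeasurableSpace Ω] {μ : Measure Ω} [IsProbabilityMeasure μ] {n m : ℕ}
  {S : LinearSystem Ω n m} {U : ℕ → Matrix (Fin n) (Fin n) ℝ} {D : ℕ → Fin n → ℝ}
  {thr : (k : ℕ) → (Fin k → Bool) → ℝ}

theorem gam_zero (ω : Ω) : S.gam μ U D thr 0 ω = true := decision_zero _ _

theorem gam_of_pos {k : ℕ} (hk : 0 < k) (ω : Ω) :
    S.gam μ U D thr k ω = decide (thr k (fun j => S.gam μ U D thr j ω) <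
      ∑ i ∈ Finset.Ioc (lastTransmission fun j : Fin k => S.gam μ U D thr j ω) k,
        ‖S.innov μ U D i ω‖ ^ 2) := decision_of_pos _ _ hk

theorem measurable_gam (k : ℕ) : Measurable[S.obs (k + 1)] (S.gam μ U D thr k) := by
  induction k using Nat.strong_induction_on with
  | _ k ih =>
    rcases Nat.eq_zero_or_pos k with rfl | hk
    · rw [show S.gam μ U D thr 0 = fun _ => true from funext gam_zero]
      exact measurable_const
    -- Splitting over the finitely many past histories freezes the threshold and the summation
    -- range, so no measurability of `thr` is needed.
    · let p : Set Ω := ⋃ h : Fin k → Bool,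
        (⋂ j : Fin k, {ω | S.gam μ U D thr j ω = h j}) ∩
          {ω | thr k h < ∑ i ∈ Finset.Ioc (lastTransmission h) k, ‖S.innov μ U D i ω‖ ^ 2}
      have hp : MeasurableSet[S.obs (k + 1)] p := by
        refine MeasurableSet.iUnion fun h => MeasurableSet.inter
          (MeasurableSet.iInter fun j => ?_) ?_
        · exact (ih j j.2).mono (obs_mono (by omega)) le_rfl (measurableSet_singleton (h j))
        · have hm : Measurable[S.obs (k + 1)] fun ω =>
              ∑ i ∈ Finset.Ioc (lastTransmission h) k, ‖S.innov μ U D i ω‖ ^ 2 := by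
            refine Finset.measurable_fun_sum _ fun i hi => ?_
            exact (measurable_norm.pow_const 2).comp ((measurable_innov i).mono (obs_mono
              (by have := (Finset.mem_Ioc.1 hi).2; omega)) le_rfl)
          exact hm measurableSet_Ioi
      refine measurable_to_bool ?_
      convert hp using 1
      ext ω
      simp only [Set.mem_preimage, Set.mem_singleton_iff, p, Set.mem_iUnion, Set.mem_inter_iff,
        Set.mem_iInter, Set.mem_ofPred_eq]
      rw [gam_of_pos hk, decide_eq_true_iff]
      constructor
      · exact fun h => ⟨fun j => S.gam μ U D thr j ω, fun j => rfl, h⟩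
      · rintro ⟨h, hh, hlt⟩
        rwa [← funext hh] at hlt

/-- The transmitted data at time `j`. -/
def sent (S : LinearSystem Ω n m) (μ : Measure Ω) (U : ℕ → Matrix (Fin n) (Fin n) ℝ)
    (D : ℕ → Fin n → ℝ) (thr : (k : ℕ) → (Fin k → Bool) → ℝ) (j : ℕ) (ω : Ω) :
    EuclideanSpace ℝ (Fin n) :=
  if S.gam μ U D thr j ω = true then S.xLoc μ j ω else 0

theorem measurable_sent (j : ℕ) : Measurable[S.obs (j + 1)] (S.sent μ U D thr j) :=
  Measurable.ite (measurable_gam j (measurableSet_singleton true)) (measurable_xLoc j)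
    measurable_const

theorem measurable_gam_info {j k : ℕ} (h : j ≤ k) :
    Measurable[S.info μ U D thr k] (S.gam μ U D thr j) :=
  measurable_iff_comap_le.2 (le_sup_left.trans
    (le_iSup (fun j : Fin (k + 1) => sigmaOf (S.gam μ U D thr j) ⊔ sigmaOf (S.sent μ U D thr j))
      ⟨j, by omega⟩))

theorem measurable_sent_info {j k : ℕ} (h : j ≤ k) :
    Measurable[S.info μ U D thr k] (S.sent μ U D thr j) :=
  measurable_iff_comap_le.2 (le_sup_right.trans
    (le_iSup (fun j : Fin (k + 1) => sigmaOf (S.gam μ U D thr j) ⊔ sigmaOf (S.sent μ U D thr j))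
      ⟨j, by omega⟩))

theorem info_le_obs (k : ℕ) : S.info μ U D thr k ≤ S.obs (k + 1) :=
  iSup_le fun j => sup_le
    (measurable_iff_comap_le.1 ((measurable_gam j).mono (obs_mono (by omega)) le_rfl))
    (measurable_iff_comap_le.1 ((measurable_sent j).mono (obs_mono (by omega)) le_rfl))

/-- The event that the decisions up to time `k` follow the history `g`. -/
def histSet (S : LinearSystem Ω n m) (μ : Measure Ω) (U : ℕ → Matrix (Fin n) (Fin n) ℝ)
    (D : ℕ → Fin n → ℝ) (thr : (k : ℕ) → (Fin k → Bool) → ℝ) (g : ℕ → Bool) (k : ℕ) : Set Ω :=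
  {ω | ∀ j ≤ k, S.gam μ U D thr j ω = g j}

theorem histSet_eq_iInter (g : ℕ → Bool) (k : ℕ) : S.histSet μ U D thr g k =
    ⋂ j : Fin (k + 1), S.gam μ U D thr j ⁻¹' {g j} := by
  ext ω
  simp only [histSet, Set.mem_ofPred_eq, Set.mem_iInter, Set.mem_preimage, Set.mem_singleton_iff]
  exact ⟨fun h j => h j (by omega), fun h j hj => h ⟨j, by omega⟩⟩

theorem measurableSet_histSet_info (g : ℕ → Bool) (k : ℕ) :
    MeasurableSet[S.info μ U D thr k] (S.histSet μ U D thr g k) := by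
  rw [histSet_eq_iInter]
  exact MeasurableSet.iInter fun j =>
    measurable_gam_info (by omega) (measurableSet_singleton _)

theorem measurableSet_histSet_obs (g : ℕ → Bool) (k : ℕ) :
    MeasurableSet[S.obs (k + 1)] (S.histSet μ U D thr g k) :=
  info_le_obs k _ (measurableSet_histSet_info g k)

/-- The normalized innovations after time `t`, stacked. -/
def innovStack (S : LinearSystem Ω n m) (μ : Measure Ω) (U : ℕ → Matrix (Fin n) (Fin n) ℝ)
    (D : ℕ → Fin n → ℝ) (t τ : ℕ) (ω : Ω) : PiLp 2 fun _ : Fin τ => EuclideanSpace ℝ (Fin S.q) :=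
  WithLp.toLp 2 fun s : Fin τ => S.innov μ U D (t + 1 + s) ω

theorem histSet_eq_inter {g : ℕ → Bool} {t τ : ℕ} (ht : g t = true)
    (hg : ∀ j, t < j → j ≤ t + τ → g j = false) :
    S.histSet μ U D thr g (t + τ) = S.histSet μ U D thr g t ∩
      S.innovStack μ U D t τ ⁻¹' silentSet thr g t τ S.q := by
  ext ω
  exact decision_eq_iff_of_silent ht hg

/-- On a history that is silent after time `t`, the remote center knows nothing beyond the
measurements up to `t` and the history itself. -/
theorem exists_obs_inter_histSet_eq {g : ℕ → Bool} {t k : ℕ}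
    (hg : ∀ j, t < j → j ≤ k → g j = false) {s : Set Ω} (hs : MeasurableSet[S.info μ U D thr k] s) :
    ∃ s', MeasurableSet[S.obs (t + 1)] s' ∧
      s ∩ S.histSet μ U D thr g k = s' ∩ S.histSet μ U D thr g k := by
  set H := S.histSet μ U D thr g k with hH
  -- The right side consists of the sets whose trace on `H` is the trace of a set in `S.obs (t +
  -- 1)`. On `H` all decisions are constant and the data sent after `t` are 0, so every generator
  -- qualifies.
  have key : S.info μ U D thr k ≤ MeasurableSpace.map ((↑) : H → Ω)
      (MeasurableSpace.comap ((↑) : H → Ω) (S.obs (t + 1))) := by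
    have hval : Measurable[MeasurableSpace.comap ((↑) : H → Ω) (S.obs (t + 1)), S.obs (t + 1)]
        ((↑) : H → Ω) := comap_measurable _
    refine iSup_le fun j => sup_le ?_ ?_
    · rintro _ ⟨B, -, rfl⟩
      rw [MeasurableSpace.map_def]
      have : ((↑) : H → Ω) ⁻¹' (S.gam μ U D thr j ⁻¹' B) = {_ω | g j ∈ B} := by
        ext ω
        simp only [Set.mem_preimage, Set.mem_ofPred_eq, ω.2 j (by omega)]
      rw [this]
      exact MeasurableSet.const _
    · change sigmaOf (S.sent μ U D thr j) ≤ _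
      rintro _ ⟨B, hB, rfl⟩
      rw [MeasurableSpace.map_def]
      rcases le_or_gt (j : ℕ) t with hjt | hjt
      · exact hval ((measurable_sent j).mono (obs_mono (by omega)) le_rfl hB)
      · have : ((↑) : H → Ω) ⁻¹' (S.sent μ U D thr j ⁻¹' B) = {_ω | 0 ∈ B} := by
          ext ω
          have h1 : S.gam μ U D thr j ω = false := by
            rw [ω.2 j (by omega), hg j hjt (by omega)]
          simp [sent, h1]
        rw [this]
        exact MeasurableSet.const _
  obtain ⟨s', hs', heq⟩ := key s hs
  refine ⟨s', hs', ?_⟩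
  rw [Set.inter_comm, Set.inter_comm s', ← Subtype.image_preimage_coe, ← Subtype.image_preimage_coe,
    heq]

end LinearSystem

/-! ### Spectral bound for block-diagonal matrices -/

section Blocks

variable {ι κ : Type*} [Fintype ι] [Fintype κ] [DecidableEq ι] [DecidableEq κ]

theorem dotProduct_blockDiagonal_mulVec (M : κ → Matrix ι ι ℝ) (x y : ι × κ → ℝ) :
    x ⬝ᵥ Matrix.blockDiagonal M *ᵥ y =
      ∑ k, (fun a => x (a, k)) ⬝ᵥ M k *ᵥ fun a => y (a, k) := by
  simp only [dotProduct, Matrix.mulVec, Fintype.sum_prod_type, Matrix.blockDiagonal_apply]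
  rw [Finset.sum_comm]
  refine Finset.sum_congr rfl fun k _ => Finset.sum_congr rfl fun a _ => ?_
  congr 1
  refine Finset.sum_congr rfl fun b _ => ?_
  simp

theorem Matrix.PosSemidef.blockDiagonal {M : κ → Matrix ι ι ℝ} (hM : ∀ k, (M k).PosSemidef) :
    (Matrix.blockDiagonal M).PosSemidef := by
  refine .of_dotProduct_mulVec_nonneg ?_ fun x => ?_
  · rw [Matrix.IsHermitian, Matrix.blockDiagonal_conjTranspose]
    exact congrArg _ (funext fun k => (hM k).isHermitian)
  · rw [dotProduct_blockDiagonal_mulVec]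
    exact Finset.sum_nonneg fun k _ => (hM k).dotProduct_mulVec_nonneg _

/-- The quadratic form of a block is bounded by the maximum eigenvalue of a block-diagonal
matrix. -/
theorem inner_block_le_lambdaMax {M : κ → Matrix ι ι ℝ} (hM : ∀ k, (M k).PosSemidef) (k : κ)
    (u : EuclideanSpace ℝ ι) :
    inner ℝ u (Matrix.toLpLin 2 2 (M k) u) ≤ lambdaMax (Matrix.blockDiagonal M) * ‖u‖ ^ 2 := by
  have h := inner_toLpLin_le_lambdaMax (Matrix.PosSemidef.blockDiagonal hM).isHermitian
    (WithLp.toLp 2 fun p : ι × κ => if p.2 = k then u p.1 else 0)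
  have h1 : ‖(WithLp.toLp 2 fun p : ι × κ => if p.2 = k then u p.1 else 0 :
      EuclideanSpace ℝ (ι × κ))‖ ^ 2 = ‖u‖ ^ 2 := by
    rw [EuclideanSpace.real_norm_sq_eq, EuclideanSpace.real_norm_sq_eq]
    simp only [Fintype.sum_prod_type]
    refine Finset.sum_congr rfl fun a _ => ?_
    simp [ite_pow]
  rw [h1] at h
  refine le_trans (le_of_eq ?_) h
  rw [EuclideanSpace.inner_eq_star_dotProduct, EuclideanSpace.inner_eq_star_dotProduct,
    dotProduct_comm, dotProduct_comm (Matrix.toLpLin 2 2 (Matrix.blockDiagonal M) _).ofLp]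
  simp only [Matrix.toLpLin_apply, star_trivial]
  rw [dotProduct_blockDiagonal_mulVec, Finset.sum_eq_single k]
  · simp
  · intro l _ hl
    simp [hl, dotProduct]
  · simp

end Blocks

/-! ### Conditional mean squared error -/

section ConditionalExpectation

variable {Ω : Type*} {m m0 : MeasurableSpace Ω} {μ : Measure Ω} [IsProbabilityMeasure μ]

/-- The conditional mean minimizes the conditional mean squared error. -/
theorem condExp_sq_sub_condExp_le (hm : m ≤ m0) {X c : Ω → ℝ} (hX : MemLp X 2 μ)
    (hc : MemLp c 2 μ) (hcm : Measurable[m] c) :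
    μ[fun ω => (X ω - (μ[X | m]) ω) * (X ω - (μ[X | m]) ω) | m] ≤ᵐ[μ]
      μ[fun ω => (X ω - c ω) ^ 2 | m] := by
  have h1 := condVar_ae_le_condExp_sq hm (hX.sub hc)
  have h2 := condExp_sub (hX.integrable one_le_two) (hc.integrable one_le_two) m
  rw [condExp_of_stronglyMeasurable hm hcm.stronglyMeasurable (hc.integrable one_le_two)] at h2
  have h3 : Var[X - c; μ | m] =ᵐ[μ]
      μ[fun ω => (X ω - (μ[X | m]) ω) * (X ω - (μ[X | m]) ω) | m] := by
    refine condExp_congr_ae ?_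
    filter_upwards [h2] with ω hω
    simp only [Pi.pow_apply, Pi.sub_apply] at hω ⊢
    rw [hω]
    ring
  filter_upwards [h1, h3] with ω h1 h3
  rw [← h3]
  exact h1

theorem setIntegral_eq_mul_of_indep {m₁ : MeasurableSpace Ω} (h₁ : m₁ ≤ m0) (hm : m ≤ m0)
    {f : Ω → ℝ} (hf : Integrable f μ) (hfm : Measurable[m₁] f) (hind : Indep m₁ m μ) {s : Set Ω}
    (hs : MeasurableSet[m] s) : ∫ ω in s, f ω ∂μ = μ.real s * ∫ ω, f ω ∂μ := by
  rw [← setIntegral_condExp hm hf hs,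
    setIntegral_congr_ae (hm s hs) ((condExp_indep_eq h₁ hm hfm.stronglyMeasurable hind).mono
      fun _ h _ => h), setIntegral_const, smul_eq_mul]

/-- A pointwise bound of a conditional expectation on an event follows from bounds of integrals. -/
theorem condExp_le_on_of_setIntegral_le (hm : m ≤ m0) {f : Ω → ℝ} (hf : Integrable f μ) {H : Set Ω}
    (hH : MeasurableSet[m] H) {b : ℝ}
    (hb : ∀ s, MeasurableSet[m] s → s ⊆ H → ∫ ω in s, f ω ∂μ ≤ b * μ.real s) :
    ∀ᵐ ω ∂μ, ω ∈ H → (μ[f | m]) ω ≤ b := by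
  set g := μ[f | m] with hg
  have hgm : Measurable[m] g := stronglyMeasurable_condExp.measurable
  have hgi : Integrable g μ := integrable_condExp
  -- Testing `hb` on the part of `H` where the bound fails forces that part to be null.
  set s := H ∩ {ω | b < g ω} with hs
  have hsm : MeasurableSet[m] s := hH.inter (hgm measurableSet_Ioi)
  have h1 : ∫ ω in s, (g ω - b) ∂μ ≤ 0 := by
    rw [integral_sub hgi.integrableOn (integrable_const b).integrableOn, setIntegral_const,
      smul_eq_mul, setIntegral_condExp hm hf hsm, mul_comm, sub_nonpos]
    exact hb s hsm Set.inter_subset_left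
  have h2 : μ s = 0 := by
    by_contra h0
    have hpos := (setIntegral_pos_iff_support_of_nonneg_ae (μ := μ) (f := fun ω => g ω - b)
      ((ae_restrict_iff' (hm s hsm)).2 (.of_forall fun ω hω => sub_nonneg.2 hω.2.le))
      (hgi.sub (integrable_const b)).integrableOn).2 ?_
    · exact absurd h1 (not_le.2 hpos)
    · have : (Function.support fun ω => g ω - b) ∩ s = s :=
        Set.inter_eq_right.2 fun ω hω => (sub_pos.2 hω.2).ne'
      rw [this]
      exact pos_iff_ne_zero.2 h0
  filter_upwards [measure_eq_zero_iff_ae_notMem.1 h2] with ω hω hωH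
  by_contra hlt
  exact hω ⟨hωH, not_le.1 hlt⟩

end ConditionalExpectation

/-! ### Mean squared error on a silent history -/

namespace LinearSystem

variable {Ω : Type*} [MeasurableSpace Ω] {μ : Measure Ω} [IsProbabilityMeasure μ] {n m : ℕ}
  {S : LinearSystem Ω n m} {U : ℕ → Matrix (Fin n) (Fin n) ℝ} {D : ℕ → Fin n → ℝ}
  {thr : (k : ℕ) → (Fin k → Bool) → ℝ}

theorem measurable_innov_pi (t τ : ℕ) :
    Measurable[S.obs (t + 1 + τ)] fun ω (s : Fin τ) => S.innov μ U D (t + 1 + s) ω :=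
  @measurable_pi_lambda _ _ _ (S.obs (t + 1 + τ)) _ _ fun s =>
    (measurable_innov (t + 1 + s)).mono (obs_mono (by omega)) le_rfl

theorem measurable_innovStack (t τ : ℕ) :
    Measurable[S.obs (t + 1 + τ)] (S.innovStack μ U D t τ) :=
  (WithLp.measurable_toLp 2 _).comp (measurable_innov_pi t τ)

/-- Each new innovation is independent of all earlier measurements, which determine both `S.obs (t +
1)` and the stack so far. -/
theorem IsGaussian.indep_innovStack (hS : S.IsGaussian μ) (t τ : ℕ) :
    Indep (sigmaOf (S.innovStack μ U D t τ)) (S.obs (t + 1)) μ := by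
  induction τ with
  | zero =>
    have : sigmaOf (S.innovStack μ U D t 0) ≤ ⊥ := by
      rintro _ ⟨B, -, rfl⟩
      rw [MeasurableSpace.measurableSet_bot_iff]
      by_cases h : (0 : PiLp 2 fun _ : Fin 0 => EuclideanSpace ℝ (Fin S.q)) ∈ B
      · exact Or.inr (Set.eq_univ_of_forall fun ω => by
          rwa [Set.mem_preimage, Subsingleton.elim (S.innovStack μ U D t 0 ω) 0])
      · exact Or.inl (Set.eq_empty_of_forall_notMem fun ω => by
          rwa [Set.mem_preimage, Subsingleton.elim (S.innovStack μ U D t 0 ω) 0])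
    exact indep_of_indep_of_le_left (indep_bot_left _) this
  | succ τ ih =>
    have h1 : sigmaOf (S.innovStack μ U D t τ) ≤ S.obs (t + 1 + τ) :=
      measurable_iff_comap_le.1 (measurable_innovStack t τ)
    have h2 : sigmaOf (S.innov μ U D (t + 1 + τ)) ≤ ‹MeasurableSpace Ω› :=
      (measurable_iff_comap_le.1 (measurable_innov (t + 1 + τ))).trans (hS.obs_le _)
    have h3 := indep_sup_of_indep_sup (hS.obs_le (t + 1)) (h1.trans (hS.obs_le _)) h2 ih.symm
      (indep_of_indep_of_le_left (hS.indep_innov (t + 1 + τ)).symm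
        (sup_le (obs_mono (by omega)) h1))
    have h4 : Measurable[sigmaOf (S.innovStack μ U D t τ) ⊔ sigmaOf (S.innov μ U D (t + 1 + τ))]
        (S.innovStack μ U D t (τ + 1)) := by
      refine (WithLp.measurable_toLp 2 _).comp (@measurable_pi_lambda _ _ _
        (sigmaOf (S.innovStack μ U D t τ) ⊔ sigmaOf (S.innov μ U D (t + 1 + τ))) _
        (fun ω (s : Fin (τ + 1)) => S.innov μ U D (t + 1 + s) ω) fun s => ?_)
      refine Fin.lastCases ?_ (fun s => ?_) s
      · exact (measurable_sigmaOf (S.innov μ U D (t + 1 + τ))).mono le_sup_right le_rfl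
      · have h5 : Measurable fun x : PiLp 2 fun _ : Fin τ => EuclideanSpace ℝ (Fin S.q) => x s := by
          fun_prop
        have h6 := h5.comp (measurable_sigmaOf (S.innovStack μ U D t τ))
        exact h6.mono le_sup_left le_rfl
    exact indep_of_indep_of_le_left h3.symm (measurable_iff_comap_le.1 h4)

theorem IsGaussian.hasLaw_innov_pi (hS : S.IsGaussian μ)
    (hUD : ∀ k, IsOrderedEigendecomposition (S.PPred μ k - S.PLoc μ k) (U k) (D k)) (t τ : ℕ) :
    HasLaw (fun ω (s : Fin τ) => S.innov μ U D (t + 1 + s) ω)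
      (Measure.pi fun _ => stdGaussian (EuclideanSpace ℝ (Fin S.q))) μ := by
  induction τ with
  | zero =>
    refine ⟨((measurable_innov_pi t 0).mono (hS.obs_le _) le_rfl).aemeasurable, ?_⟩
    rw [Measure.pi_of_empty, Measure.map_congr (g := fun _ s => isEmptyElim s)
      (.of_forall fun ω => Subsingleton.elim _ _)]
    simp
  | succ τ ih =>
    have h1 : sigmaOf (fun ω (s : Fin τ) => S.innov μ U D (t + 1 + s) ω) ≤ S.obs (t + 1 + τ) :=
      measurable_iff_comap_le.1 (measurable_innov_pi t τ)
    have hind : IndepFun (S.innov μ U D (t + 1 + τ))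
        (fun ω (s : Fin τ) => S.innov μ U D (t + 1 + s) ω) μ :=
      indep_of_indep_of_le_right (hS.indep_innov (t + 1 + τ)) h1
    have h2 := hind.hasLaw_prod (hS.hasLaw_innov hUD (t + 1 + τ)) ih
    have h3 := (measurePreserving_piFinSuccAbove
      (fun _ : Fin (τ + 1) => stdGaussian (EuclideanSpace ℝ (Fin S.q))) (Fin.last τ)).symm
    have h4 := h3.fun_comp_hasLaw h2
    refine h4.congr (.of_forall fun ω => ?_)
    rw [MeasurableEquiv.eq_symm_apply]
    refine Prod.ext ?_ (funext fun s => ?_)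
    · simp [MeasurableEquiv.piFinSuccAbove]
    · simp [MeasurableEquiv.piFinSuccAbove, Fin.init]

theorem IsGaussian.hasLaw_innovStack (hS : S.IsGaussian μ)
    (hUD : ∀ k, IsOrderedEigendecomposition (S.PPred μ k - S.PLoc μ k) (U k) (D k)) (t τ : ℕ) :
    HasLaw (S.innovStack μ U D t τ)
      (stdGaussian (PiLp 2 fun _ : Fin τ => EuclideanSpace ℝ (Fin S.q))) μ :=
  HasLaw.fun_comp (Y := WithLp.toLp 2) ⟨by fun_prop, map_toLp_pi_stdGaussian⟩
    (hS.hasLaw_innov_pi hUD t τ)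

/-- Iterates `x̂ᴸ_{j+1} = A x̂ᴸ_j + z_{j+1}`, which holds almost surely by the time update. -/
theorem IsGaussian.xLoc_add (hS : S.IsGaussian μ) (t τ : ℕ) :
    S.xLoc μ (t + τ) =ᵐ[μ] fun ω => Matrix.toLpLin 2 2 (S.A ^ τ) (S.xLoc μ t ω) +
      ∑ s ∈ Finset.range τ, Matrix.toLpLin 2 2 (S.A ^ (τ - 1 - s)) (S.z μ (t + 1 + s) ω) := by
  induction τ with
  | zero =>
    refine .of_forall fun ω => ?_
    simp
  | succ τ ih =>
    filter_upwards [ih, hS.xPred_succ (t + τ)] with ω h1 h2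
    have h3 : S.xLoc μ (t + (τ + 1)) ω = S.xPred μ (t + τ + 1) ω + S.z μ (t + τ + 1) ω := by
      rw [LinearSystem.z, add_sub_cancel]
      rfl
    have hA : ∀ (i : ℕ) (v : EuclideanSpace ℝ (Fin n)), Matrix.toLpLin 2 2 S.A
        (Matrix.toLpLin 2 2 (S.A ^ i) v) = Matrix.toLpLin 2 2 (S.A ^ (i + 1)) v := fun i v => by
      rw [pow_succ' S.A, Matrix.toLpLin_mul_same]
      rfl
    rw [h3, h2, h1, map_add, map_sum, hA, Finset.sum_range_succ, add_assoc]
    congr 2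
    · refine Finset.sum_congr rfl fun s hs => ?_
      have := Finset.mem_range.1 hs
      rw [hA]
      congr 3
      omega
    · rw [show τ + 1 - 1 - τ = 0 by omega, pow_zero, Matrix.toLpLin_one,
        show t + 1 + τ = t + τ + 1 by omega]
      rfl

/-- The matrices expressing the accumulated innovation through the normalized innovations. -/
def stackGain (S : LinearSystem Ω n m) (μ : Measure Ω) (U : ℕ → Matrix (Fin n) (Fin n) ℝ)
    (D : ℕ → Fin n → ℝ) (t τ : ℕ) (s : Fin τ) :
    EuclideanSpace ℝ (Fin S.q) →L[ℝ] EuclideanSpace ℝ (Fin n) :=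
  LinearMap.toContinuousLinearMap
    (Matrix.toLpLin 2 2 (S.A ^ (τ - 1 - s) * S.innovGain μ U D (t + 1 + s)))

theorem IsGaussian.xLoc_add_eq_innovStack (hS : S.IsGaussian μ)
    (hUD : ∀ k, IsOrderedEigendecomposition (S.PPred μ k - S.PLoc μ k) (U k) (D k)) (t τ : ℕ) :
    S.xLoc μ (t + τ) =ᵐ[μ] fun ω => Matrix.toLpLin 2 2 (S.A ^ τ) (S.xLoc μ t ω) +
      ∑ s, S.stackGain μ U D t τ s (S.innovStack μ U D t τ ω s) := by
  filter_upwards [hS.xLoc_add t τ, ae_all_iff.2 fun k => hS.z_eq_innov hUD k] with ω h1 h2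
  rw [h1, Finset.sum_range]
  congr 1
  refine Finset.sum_congr rfl fun s _ => ?_
  rw [h2, stackGain, LinearMap.coe_toContinuousLinearMap', Matrix.toLpLin_mul (q := 2)]
  rfl

theorem IsGaussian.norm_sq_stackGain_le (hS : S.IsGaussian μ)
    (hUD : ∀ k, IsOrderedEigendecomposition (S.PPred μ k - S.PLoc μ k) (U k) (D k)) (t τ : ℕ)
    (s : Fin τ) (v : EuclideanSpace ℝ (Fin S.q)) :
    ‖S.stackGain μ U D t τ s v‖ ^ 2 ≤ lambdaMax (S.AP μ (t + τ) τ) * ‖v‖ ^ 2 := by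
  have hps : ∀ i : Fin τ, (S.A ^ (i : ℕ) * (S.PPred μ (t + τ - i) - S.PLoc μ (t + τ - i)) *
      (S.A ^ (i : ℕ))ᵀ).PosSemidef := fun i =>
    (hS.hasEstimationError _).posSemidef_innovation.mul_mul_conjTranspose_same _
  refine norm_sq_toLpLin_le (lambdaMax_nonneg (Matrix.PosSemidef.blockDiagonal hps)) (fun u => ?_) v
  -- The stack runs forward from `t + 1` while the blocks of `AP` run backward from `k`, hence the
  -- reversed index.
  have h := inner_block_le_lambdaMax hps ⟨τ - 1 - s, by omega⟩ u
  have h1 : t + τ - (τ - 1 - s) = t + 1 + s := by omega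
  simp only [h1] at h
  rw [Matrix.transpose_mul, Matrix.mul_assoc, ← Matrix.mul_assoc (S.innovGain μ U D _),
    hS.innovGain_mul_transpose hUD, ← Matrix.mul_assoc]
  exact h

theorem IsGaussian.memLp_error (hS : S.IsGaussian μ) (k : ℕ) :
    MemLp (fun ω => S.x k ω - S.xLoc μ k ω) 2 μ :=
  memLp_two_of_hasLaw_multivariateGaussian (hS.hasEstimationError k).law

theorem IsGaussian.memLp_xLoc (hS : S.IsGaussian μ) (k : ℕ) : MemLp (S.xLoc μ k) 2 μ := by
  have := (hS.memLp_x k).sub (hS.memLp_error k)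
  refine this.ae_eq (.of_forall fun ω => ?_)
  simp

theorem IsGaussian.memLp_sent (hS : S.IsGaussian μ) (k : ℕ) : MemLp (S.sent μ U D thr k) 2 μ := by
  refine (hS.memLp_xLoc k).mono
    ((measurable_sent k).mono (hS.obs_le _) le_rfl).aestronglyMeasurable (.of_forall fun ω => ?_)
  rw [sent]
  split_ifs <;> simp

/-- The mean squared error of the remote estimate is at most that of any estimate the remote center
can form. -/
theorem IsGaussian.trace_PRem_le (hS : S.IsGaussian μ) (k : ℕ)
    {c : Ω → EuclideanSpace ℝ (Fin n)} (hc : MemLp c 2 μ) (hcm : Measurable[S.info μ U D thr k] c) :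
    ∀ᵐ ω ∂μ, (S.PRem μ U D thr k ω).trace ≤
      (μ[fun ω => ‖S.x k ω - c ω‖ ^ 2 | S.info μ U D thr k]) ω := by
  have hI : S.info μ U D thr k ≤ ‹MeasurableSpace Ω› := (info_le_obs k).trans (hS.obs_le _)
  have hcoord : ∀ {f : Ω → EuclideanSpace ℝ (Fin n)}, MemLp f 2 μ → ∀ i,
      MemLp (fun ω => f ω i) 2 μ := fun hf i => (EuclideanSpace.proj (𝕜 := ℝ) i).comp_memLp' hf
  have h1 : ∀ i, (fun ω => S.PRem μ U D thr k ω i i) ≤ᵐ[μ]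
      μ[fun ω => (S.x k ω i - c ω i) ^ 2 | S.info μ U D thr k] := by
    intro i
    have h2 := condExp_sq_sub_condExp_le hI (hcoord (hS.memLp_x k) i) (hcoord hc i)
      ((EuclideanSpace.proj (𝕜 := ℝ) i).measurable.comp hcm)
    have h3 := (EuclideanSpace.proj (𝕜 := ℝ) i).comp_condExp_comm (m := S.info μ U D thr k)
      ((hS.memLp_x k).integrable one_le_two)
    have h4 : μ[fun ω' => (S.x k ω' - S.xRem μ U D thr k ω') i *
        (S.x k ω' - S.xRem μ U D thr k ω') i | S.info μ U D thr k] =ᵐ[μ]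
        μ[fun ω => (S.x k ω i - (μ[fun ω => S.x k ω i | S.info μ U D thr k]) ω) *
          (S.x k ω i - (μ[fun ω => S.x k ω i | S.info μ U D thr k]) ω) | S.info μ U D thr k] := by
      refine condExp_congr_ae ?_
      filter_upwards [h3] with ω hω
      have h5 : S.xRem μ U D thr k ω i = (μ[fun ω => S.x k ω i | S.info μ U D thr k]) ω := hω
      simp only [PiLp.sub_apply, h5]
    filter_upwards [h2, h4] with ω h2 h4
    exact h4.trans_le h2
  have h6 : μ[fun ω => ‖S.x k ω - c ω‖ ^ 2 | S.info μ U D thr k] =ᵐ[μ]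
      ∑ i, μ[fun ω => (S.x k ω i - c ω i) ^ 2 | S.info μ U D thr k] := by
    rw [show (fun ω => ‖S.x k ω - c ω‖ ^ 2) =
        ∑ i, fun ω => (S.x k ω i - c ω i) ^ 2 from funext fun ω => by
      simp [EuclideanSpace.real_norm_sq_eq]]
    exact condExp_finsetSum (fun i _ =>
      ((hcoord (hS.memLp_x k) i).sub (hcoord hc i)).integrable_sq) _
  filter_upwards [ae_all_iff.2 h1, h6] with ω h1 h6
  rw [h6, Finset.sum_apply, Matrix.trace]
  exact Finset.sum_le_sum fun i _ => h1 i

theorem IsGaussian.integral_norm_sq_error (hS : S.IsGaussian μ) (k : ℕ) :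
    ∫ ω, ‖S.x k ω - S.xLoc μ k ω‖ ^ 2 ∂μ = (S.PLoc μ k).trace := by
  have hcoord : ∀ i, MemLp (fun ω => (S.x k ω - S.xLoc μ k ω) i) 2 μ := fun i =>
    (EuclideanSpace.proj (𝕜 := ℝ) i).comp_memLp' (hS.memLp_error k)
  simp_rw [EuclideanSpace.real_norm_sq_eq]
  rw [integral_finsetSum _ fun i _ => (hcoord i).integrable_sq, Matrix.trace]
  refine Finset.sum_congr rfl fun i _ => ?_
  simp only [Matrix.diag_apply, PLoc, Matrix.of_apply, sq]

/-- The estimation error is orthogonal to functions of the measurements. -/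
theorem IsGaussian.setIntegral_inner_error_eq_zero (hS : S.IsGaussian μ) (k : ℕ)
    {W : Ω → EuclideanSpace ℝ (Fin n)} (hW : MemLp W 2 μ) (hWm : Measurable[S.obs (k + 1)] W)
    {s : Set Ω} (hs : MeasurableSet[S.obs (k + 1)] s) :
    ∫ ω in s, inner ℝ (S.x k ω - S.xLoc μ k ω) (W ω) ∂μ = 0 := by
  have hs' := hS.obs_le _ s hs
  have he := hS.hasEstimationError k
  rw [← integral_indicator hs']
  have h1 : ∀ ω, s.indicator (fun ω => inner ℝ (S.x k ω - S.xLoc μ k ω) (W ω)) ω =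
      ∑ i, (S.x k ω - S.xLoc μ k ω) i * s.indicator W ω i := by
    intro ω
    by_cases hω : ω ∈ s
    · rw [Set.indicator_of_mem hω, Set.indicator_of_mem hω, PiLp.inner_apply]
      exact Finset.sum_congr rfl fun i _ => mul_comm _ _
    · rw [Set.indicator_of_notMem hω, Set.indicator_of_notMem hω]
      simp
  have hWs : Measurable[S.obs (k + 1)] (s.indicator W) := hWm.indicator hs
  have hproj : ∀ i, Measurable fun x : EuclideanSpace ℝ (Fin n) => x i := fun i => by fun_prop
  have hind : IndepFun (fun ω => S.x k ω - S.xLoc μ k ω) (s.indicator W) μ :=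
    indep_of_indep_of_le_right he.indep (measurable_iff_comap_le.1 hWs)
  have hcoord : ∀ {f : Ω → EuclideanSpace ℝ (Fin n)}, MemLp f 2 μ → ∀ i,
      MemLp (fun ω => f ω i) 2 μ := fun hf i => (EuclideanSpace.proj (𝕜 := ℝ) i).comp_memLp' hf
  have hm1 := hS.memLp_error k
  have hm2 : MemLp (s.indicator W) 2 μ := hW.indicator hs'
  have hint : ∀ i, Integrable (fun ω => (S.x k ω - S.xLoc μ k ω) i * s.indicator W ω i) μ :=
    fun i => (hcoord hm1 i).integrable_mul (hcoord hm2 i)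
  simp_rw [h1]
  rw [integral_finsetSum _ fun i _ => hint i]
  refine Finset.sum_eq_zero fun i _ => ?_
  refine ((hind.comp (hproj i) (hproj i)).integral_fun_mul_eq_mul_integral (hcoord hm1 i).1
    (hcoord hm2 i).1).trans ?_
  have h0 : ∫ ω, (S.x k ω - S.xLoc μ k ω) i ∂μ = 0 := by
    have := (EuclideanSpace.proj (𝕜 := ℝ) i).integral_comp_comm (hm1.integrable one_le_two)
    rw [integral_of_hasLaw_multivariateGaussian he.law] at this
    simpa using this
  have h0' : ∫ ω, ((fun x : EuclideanSpace ℝ (Fin n) => x i) ∘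
      fun ω => S.x k ω - S.xLoc μ k ω) ω ∂μ = 0 := h0
  rw [h0', zero_mul]

/-- On a history that is silent for `τ` steps after a transmission at time `t`, the mean squared
error of the prediction from the transmitted estimate. -/
theorem IsGaussian.setIntegral_norm_sq_sub_sent_le (hS : S.IsGaussian μ)
    (hUD : ∀ k, IsOrderedEigendecomposition (S.PPred μ k - S.PLoc μ k) (U k) (D k))
    {g : ℕ → Bool} {t τ : ℕ} (hτ : 0 < τ) (ht : g t = true)
    (hg : ∀ j, t < j → j ≤ t + τ → g j = false) {s : Set Ω}
    (hs : MeasurableSet[S.info μ U D thr (t + τ)] s) (hsH : s ⊆ S.histSet μ U D thr g (t + τ)) :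
    ∫ ω in s, ‖S.x (t + τ) ω -
        Matrix.toLpLin 2 2 (S.A ^ τ) (S.sent μ U D thr t ω)‖ ^ 2 ∂μ ≤
      ((S.PLoc μ (t + τ)).trace + τ * S.q * chiSqRatio S.q τ (thr (t + τ) fun j => g j) *
        lambdaMax (S.AP μ (t + τ) τ)) * μ.real s := by
  set k := t + τ with hk
  set E := PiLp 2 fun _ : Fin τ => EuclideanSpace ℝ (Fin S.q)
  set X := S.innovStack μ U D t τ with hX
  set G := silentSet thr g t τ S.q with hG
  set W : Ω → EuclideanSpace ℝ (Fin n) := fun ω => ∑ r, S.stackGain μ U D t τ r (X ω r) with hW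
  have hsobs : MeasurableSet[S.obs (k + 1)] s := info_le_obs k _ hs
  have hsm : MeasurableSet s := hS.obs_le _ s hsobs
  have hXobs : Measurable[S.obs (k + 1)] X :=
    (measurable_innovStack t τ).mono (obs_mono (by omega)) le_rfl
  have hXlaw := hS.hasLaw_innovStack hUD t τ
  have hGm : MeasurableSet G := measurableSet_silentSet thr g t τ S.q
  let Bsum : E →L[ℝ] EuclideanSpace ℝ (Fin n) := ∑ r, (S.stackGain μ U D t τ r).comp
    (PiLp.proj 2 (𝕜 := ℝ) (fun _ : Fin τ => EuclideanSpace ℝ (Fin S.q)) r)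
  have hBsum : ∀ x : E, Bsum x = ∑ r, S.stackGain μ U D t τ r (x r) := fun x => by
    simp only [Bsum, sum_apply]
    rfl
  have hWeq : W = fun ω => Bsum (X ω) := funext fun ω => (hBsum _).symm
  have hXmem : MemLp X 2 μ := by
    have h := IsGaussian.memLp_two_id (μ := stdGaussian E)
    rw [← hXlaw.map_eq] at h
    exact (memLp_map_measure_iff (by fun_prop) hXlaw.aemeasurable).1 h
  have hWmem : MemLp W 2 μ := by
    rw [hWeq]
    exact Bsum.comp_memLp' hXmem
  have hWobs : Measurable[S.obs (k + 1)] W := by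
    rw [hWeq]
    exact Bsum.measurable.comp hXobs
  have hemem := hS.memLp_error k
  have he := hS.hasEstimationError k
  -- the decomposition of the error on `s`
  have hdec : ∀ᵐ ω ∂μ, ω ∈ s → ‖S.x k ω -
      Matrix.toLpLin 2 2 (S.A ^ τ) (S.sent μ U D thr t ω)‖ ^ 2 =
      ‖S.x k ω - S.xLoc μ k ω‖ ^ 2 + 2 * inner ℝ (S.x k ω - S.xLoc μ k ω) (W ω) + ‖W ω‖ ^ 2 := by
    filter_upwards [hS.xLoc_add_eq_innovStack hUD t τ] with ω hω hωs
    have h1 : S.sent μ U D thr t ω = S.xLoc μ t ω := by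
      rw [sent, hsH hωs t (by omega), ht, if_pos rfl]
    rw [← norm_add_sq_real, h1, hω]
    congr 2
    simp only [hW]
    abel
  have hi1 : Integrable (fun ω => ‖S.x k ω - S.xLoc μ k ω‖ ^ 2) μ :=
    hemem.integrable_norm_pow (by norm_num)
  have hi2 : Integrable (fun ω => inner ℝ (S.x k ω - S.xLoc μ k ω) (W ω)) μ := by
    refine Integrable.mono' (hemem.norm.integrable_mul hWmem.norm) (hemem.1.inner hWmem.1)
      (.of_forall fun ω => norm_inner_le_norm _ _)
  have hi3 : Integrable (fun ω => ‖W ω‖ ^ 2) μ := hWmem.integrable_norm_pow (by norm_num)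
  have hi2' : Integrable (fun ω => 2 * inner ℝ (S.x k ω - S.xLoc μ k ω) (W ω)) μ := hi2.const_mul 2
  have hi12 : Integrable (fun ω => ‖S.x k ω - S.xLoc μ k ω‖ ^ 2 +
      2 * inner ℝ (S.x k ω - S.xLoc μ k ω) (W ω)) μ := hi1.add hi2'
  have hsplit : ∫ ω in s, ‖S.x k ω -
      Matrix.toLpLin 2 2 (S.A ^ τ) (S.sent μ U D thr t ω)‖ ^ 2 ∂μ =
      μ.real s * (S.PLoc μ k).trace + ∫ ω in s, ‖W ω‖ ^ 2 ∂μ := by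
    rw [setIntegral_congr_ae hsm hdec,
      integral_add hi12.integrableOn hi3.integrableOn,
      integral_add hi1.integrableOn hi2'.integrableOn, integral_const_mul,
      hS.setIntegral_inner_error_eq_zero k hWmem hWobs hsobs, mul_zero, add_zero,
      ← hS.integral_norm_sq_error]
    congr 1
    refine setIntegral_eq_mul_of_indep ?_ (hS.obs_le _) hi1 ?_ he.indep hsobs
    · exact ((hS.measurable_x k).sub ((measurable_xLoc k).mono (hS.obs_le _) le_rfl)).comap_le
    · exact (measurable_norm.pow_const 2).comp (measurable_sigmaOf _)
  -- the set `s` in terms of the past and the later innovations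
  obtain ⟨s', hs', heq⟩ := exists_obs_inter_histSet_eq (μ := μ) (U := U) (D := D) hg hs
  set b := s' ∩ S.histSet μ U D thr g t with hb
  have hbobs : MeasurableSet[S.obs (t + 1)] b := hs'.inter (measurableSet_histSet_obs g t)
  have hbm : MeasurableSet b := hS.obs_le _ b hbobs
  -- An event `b` of the measurements up to `t` and an event of the later innovations: by
  -- independence both the measure of `s` and the integral of `‖W‖²` over `s` carry the factor
  -- `μ.real b`.
  have hseq : s = b ∩ X ⁻¹' G := by
    rw [← Set.inter_eq_left.2 hsH, heq, hk, histSet_eq_inter ht hg, hb, Set.inter_assoc]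
  have hXm : Measurable X := hXobs.mono (hS.obs_le _) le_rfl
  have hXle : sigmaOf X ≤ ‹MeasurableSpace Ω› := hXm.comap_le
  have hXG : MeasurableSet (X ⁻¹' G) := hXm hGm
  have hind := hS.indep_innovStack (U := U) (D := D) t τ
  have hGσ : MeasurableSet[sigmaOf X] (X ⁻¹' G) := measurable_sigmaOf X hGm
  have hWσ : Measurable[sigmaOf X] fun ω => ‖W ω‖ ^ 2 := by
    rw [hWeq]
    exact ((measurable_norm.pow_const 2).comp Bsum.measurable).comp (measurable_sigmaOf X)
  have hreal : μ.real s = μ.real b * (stdGaussian E).real G := by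
    have h1 : μ (b ∩ X ⁻¹' G) = μ b * μ (X ⁻¹' G) := by
      rw [Set.inter_comm, mul_comm]
      exact (Indep_iff _ _ _).1 hind _ _ hGσ hbobs
    rw [hseq, measureReal_def, h1, ENNReal.toReal_mul, ← hXlaw.map_eq,
      map_measureReal_apply hXm hGm, measureReal_def, measureReal_def]
  have hWint : ∫ ω in s, ‖W ω‖ ^ 2 ∂μ =
      μ.real b * ∫ x in G, ‖∑ r, S.stackGain μ U D t τ r (x r)‖ ^ 2 ∂(stdGaussian E) := by
    rw [hseq, ← setIntegral_indicator hXG, setIntegral_eq_mul_of_indep hXle (hS.obs_le _)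
      (hi3.indicator hXG) (hWσ.indicator hGσ) hind hbobs, integral_indicator hXG,
      ← hXlaw.map_eq, setIntegral_map hGm (by fun_prop) hXm.aemeasurable]
  have hbound := setIntegral_norm_sq_sum_blocks_le_chiSqRatio hGm
    (fun x hx y hy => mem_silentSet_of_norm_le hx y hy)
    (fun x hx => norm_sq_le_of_mem_silentSet hτ hx) (S.stackGain μ U D t τ)
    (hS.norm_sq_stackGain_le hUD t τ)
  rw [hsplit, hWint, add_mul, mul_comm (μ.real s)]
  refine add_le_add le_rfl ((mul_le_mul_of_nonneg_left hbound measureReal_nonneg).trans_eq ?_)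
  rw [hreal]
  ring

theorem IsGaussian.trace_PRem_le_of_silent (hS : S.IsGaussian μ)
    (hUD : ∀ k, IsOrderedEigendecomposition (S.PPred μ k - S.PLoc μ k) (U k) (D k))
    {g : ℕ → Bool} {t τ k : ℕ} (hk : k = t + τ) (hτ : 0 < τ) (ht : g t = true)
    (hg : ∀ j, t < j → j ≤ k → g j = false) :
    ∀ᵐ ω ∂μ, ω ∈ S.histSet μ U D thr g k → (S.PRem μ U D thr k ω).trace ≤
      (S.PLoc μ k).trace + τ * S.q * chiSqRatio S.q τ (thr k fun j => g j) *
        lambdaMax (S.AP μ k τ) := by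
  subst hk
  have hI : S.info μ U D thr (t + τ) ≤ ‹MeasurableSpace Ω› :=
    (info_le_obs _).trans (hS.obs_le _)
  have hc : MemLp (fun ω => Matrix.toLpLin 2 2 (S.A ^ τ) (S.sent μ U D thr t ω)) 2 μ :=
    (LinearMap.toContinuousLinearMap (Matrix.toLpLin 2 2 (S.A ^ τ))).comp_memLp' (hS.memLp_sent t)
  have hcm : Measurable[S.info μ U D thr (t + τ)]
      fun ω => Matrix.toLpLin 2 2 (S.A ^ τ) (S.sent μ U D thr t ω) :=
    (continuous_toLpLin _).measurable.comp (measurable_sent_info (by omega))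
  have hint : Integrable (fun ω => ‖S.x (t + τ) ω -
      Matrix.toLpLin 2 2 (S.A ^ τ) (S.sent μ U D thr t ω)‖ ^ 2) μ :=
    ((hS.memLp_x _).sub hc).integrable_norm_pow (by norm_num)
  filter_upwards [hS.trace_PRem_le (t + τ) hc hcm,
    condExp_le_on_of_setIntegral_le hI hint (measurableSet_histSet_info g (t + τ))
      fun s hs hsH => hS.setIntegral_norm_sq_sub_sent_le hUD hτ ht hg hs hsH] with ω h1 h2 hω
  exact h1.trans (h2 hω)

end LinearSystem

end

/-! ### Assembly over the finitely many histories -/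

theorem theorem3 {Ω : Type*} [MeasurableSpace Ω] (μ : Measure Ω) [IsProbabilityMeasure μ]
    {n m : ℕ} (S : LinearSystem Ω n m) (hS : S.IsGaussian μ)
    (U : ℕ → Matrix (Fin n) (Fin n) ℝ) (D : ℕ → Fin n → ℝ)
    (hUD : ∀ k, IsOrderedEigendecomposition (S.PPred μ k - S.PLoc μ k) (U k) (D k))
    (thr : (k : ℕ) → (Fin k → Bool) → ℝ) (k : ℕ) :
    ∀ᵐ ω ∂μ, S.gam μ U D thr k ω = false →
      (S.PRem μ U D thr k ω).trace ≤
        (S.PLoc μ k).trace +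
          (S.tau μ U D thr k ω : ℝ) * (S.q : ℝ) *
            chiSqRatio S.q (S.tau μ U D thr k ω) (S.delta μ U D thr k ω) *
            lambdaMax (S.AP μ k (S.tau μ U D thr k ω)) := by
  have key : ∀ h : Fin (k + 1) → Bool, ∀ᵐ ω ∂μ, (fun j : Fin (k + 1) => S.gam μ U D thr j ω) = h →
      S.gam μ U D thr k ω = false → (S.PRem μ U D thr k ω).trace ≤ (S.PLoc μ k).trace +
          (S.tau μ U D thr k ω : ℝ) * (S.q : ℝ) *
            chiSqRatio S.q (S.tau μ U D thr k ω) (S.delta μ U D thr k ω) *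
            lambdaMax (S.AP μ k (S.tau μ U D thr k ω)) := by
    intro h
    -- The values of `g` after time `k` are irrelevant.
    let g : ℕ → Bool := fun j => if hj : j < k + 1 then h ⟨j, hj⟩ else false
    have hgam : ∀ ω, (fun j : Fin (k + 1) => S.gam μ U D thr j ω) = h →
        ∀ j ≤ k, S.gam μ U D thr j ω = g j := by
      intro ω hh j hj
      simp only [g, dif_pos (Nat.lt_succ_of_le hj), ← hh]
    by_cases hok : 0 < k ∧ g 0 = true ∧ g k = false
    · obtain ⟨hk, h0, hgk⟩ := hok
      obtain ⟨htk, ht, hlast⟩ := lastTransmission_spec (h := fun j : Fin k => g j) hk h0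
      generalize htdef : lastTransmission (fun j : Fin k => g j) = t at htk ht hlast
      obtain ⟨τ, hkτ⟩ := Nat.exists_eq_add_of_le htk.le
      have hsilent : ∀ j, t < j → j ≤ k → g j = false := by
        intro j hj hjk
        rcases hjk.eq_or_lt with rfl | hlt
        · exact hgk
        · exact hlast ⟨j, hlt⟩ hj
      filter_upwards [hS.trace_PRem_le_of_silent (thr := thr) hUD hkτ (by omega) ht hsilent]
        with ω hω hh _
      have hhist : (fun j : Fin k => S.gam μ U D thr j ω) = fun j : Fin k => g j :=
        funext fun j => hgam ω hh j j.2.le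
      have htau : S.tau μ U D thr k ω = τ := by
        rw [LinearSystem.tau, hhist, htdef, hkτ, Nat.add_sub_cancel_left]
      have hdelta : S.delta μ U D thr k ω = thr k fun j => g j := by
        rw [LinearSystem.delta, hhist]
      rw [htau, hdelta]
      exact hω (hgam ω hh)
    -- The remaining histories are impossible: time 0 counts as a transmission, so silence at `k`
    -- forces `0 < k`.
    · refine .of_forall fun ω hh hk => absurd ?_ hok
      have h0 := hgam ω hh 0 (Nat.zero_le k)
      rw [LinearSystem.gam_zero] at h0
      have hgk := hgam ω hh k le_rfl
      rw [hk] at hgk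
      refine ⟨Nat.pos_of_ne_zero ?_, h0.symm, hgk.symm⟩
      rintro rfl
      rw [LinearSystem.gam_zero] at hk
      exact Bool.noConfusion hk
  filter_upwards [ae_all_iff.2 key] with ω hω
  exact hω _ rfl
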